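/- **Setting.** Let $G=SU_2\times SU_2$, with $SU_2$ the unit quaternions and $\mathfrak{su}_2=\operatorname{Im}\mathbb H$ with the commutator bracket. Let $H=\tfrac i2$, $E=\tfrac{j}{2\sqrt2}$, $V=\tfrac{k}{2\sqrt2}$, so that $[H,E]=V$, $[H,V]=-E$ and $\mathcal B(E,E)=\mathcal B(V,V)=-1$ for the Killing form $\mathcal B$. Put $U=(H,H)$, $A=(H,-H)$, $E_1=(E,0)$, $V_1=(V,0)$, $E_2=(0,E)$, $V_2=(0,V)$. Let $K=\{(\exp sH,\exp sH): s\in\mathbb R\}$ and $M=\,]a,b[\,\times G/K$ with $-\infty\le a<b\le+\infty$. Let $\xi=\partial/\partial t$, $\gamma_t=(t,eK)$, and let $\hat X$ be the vector field on $M$ induced by $X\in\mathfrak g=\mathfrak{su}_2+\mathfrak{su}_2$. Orient $M$ ($G$-invariantly) so that $(\xi,\hat A,\hat E_1,\hat V_1,\hat E_2,\hat V_2)_{\gamma_t}$ is an oriented basis of $T_{\gamma_t}M$, and let $(\xi^*,A^*,E_1^*,V_1^*,E_2^*,V_2^*)$ be the dual basis. Let $\omega^1,\dots,\omega^5$ be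 the $G$-invariant $2$-forms on $M$ which at each $\gamma_t$ equal $$\omega^1=\xi^*\wedge A^*,\quad \omega^2=E_1^*\wedge V_1^*,\quad \omega^3=E_2^*\wedge V_2^*,\quad \omega^4=E_1^*\wedge E_2^*+V_1^*\wedge V_2^*,\quad \omega^5=E_1^*\wedge V_2^*-V_1^*\wedge E_2^*,$$ and let $\psi^{1j},\psi^{2j}$ $(2\le j\le5)$ be the $G$-invariant $3$-forms which at each $\gamma_t$ equal $\xi^*\wedge\omega^j$ and $A^*\wedge\omega^j$, respectively. For a $3$-form $\theta$ on an oriented $6$-dimensional real vector space $W$ with positive volume form $\tau$, define $S_\theta\in\operatorname{End}(W)$ by $(\imath_v\theta\wedge\theta)\wedge\alpha=\alpha(S_\theta v)\,\tau$ for all $v\in W$, $\alpha\in W^*$, and $P(\theta)=\tfrac16\operatorname{tr}(S_\theta^2)$ (so $S_\theta^2=P(\theta)\,\mathrm{Id}$). The form $\theta$ is *stable* if $P(\theta)<0$, and then $J_\theta=S_\theta/\sqrt{-P(\theta)}$ is a complex structure. Both stability and $J_\theta$ are independent of the choice of $\tau$. Write $J_\theta^*\theta=\theta(J_\theta\cdot,J_\theta\cdot,J_\theta\cdot)$.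 **Theorem.** Let $\mu>0$, let $f_1,\dots,f_5$ and $p_{aj}$ ($a=1,2$, $2\le j\le 5$) be smooth real functions on $]a,b[$, and let $\omega=\sum_i f_i\,\omega^i$ and $\psi=\sum_{a,j}p_{aj}\,\psi^{aj}$. Then the following conditions are equivalent. (I) The form $\psi$ is stable at every point of $M$, $\omega$ is $J_\psi$-invariant, $$d\omega=3\psi,\qquad d(J_\psi^*\psi)=-2\mu\,\omega\wedge\omega,$$ and $g=\omega(\cdot,J_\psi\cdot)$ satisfies $g(\xi,\xi)=1$ and $g(\xi,\hat X)=0$ on $M$ for all $X\in\mathfrak g$. (No positivity or definiteness of $g$ is required.) (II) On $]a,b[$ the coefficients of $\psi$ are $$p_{22}=p_{23}=0,\quad p_{12}=\tfrac{f_2'}3+\tfrac{f_1}{12},\quad p_{13}=\tfrac{f_3'}3-\tfrac{f_1}{12},\quad p_{14}=\tfrac{f_4'}3,\quad p_{15}=\tfrac{f_5'}3,\quad p_{24}=\tfrac23f_5,\quad p_{25}=-\tfrac23f_4,$$ and there are a constant $\theta_0\in\mathbb R$ and a smooth function $F>0$ on $]a,b[$ such that: (i) $f_4=F\cos\theta_0$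 and $f_5=F\sin\theta_0$ on $]a,b[$; (ii) $f_1<0$ and $(F')^2-\big(f_2'+\tfrac{f_1}4\big)\big(f_3'-\tfrac{f_1}4\big)>0$ at all points of $]a,b[$; (iii) on $]a,b[$ the functions $f_1,f_2,f_3,F$ satisfy the differential system $$\begin{cases}\big[(f_2'+\tfrac14f_1)f_1\big]'+12\mu f_1f_2=0,\\ \big[(f_3'-\tfrac14f_1)f_1\big]'+12\mu f_1f_3=0,\\ (F'f_1)'-4\frac{F}{f_1}+12\mu f_1F=0,\\ f_1\big(f_2'-f_3'+\tfrac12f_1\big)+48\mu(f_2f_3-F^2)=0,\end{cases}$$ and there is at least one $t_0\in\,]a,b[$ such that at $t=t_0$ $$4F^2-\Big((F')^2-\big(f_2'+\tfrac{f_1}4\big)\big(f_3'-\tfrac{f_1}4\big)\Big)f_1^2=0.$$ -/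

import Mathlib

open scoped Quaternion ContDiff

noncomputable section

namespace NearlyKahler

/-! ## Multilinear algebra -/

/-- The wedge product of alternating forms, normalized by shuffles, so that
`(α ∧ β)(v, w) = α v * β w - α w * β v` for `1`-forms. -/
def wedge {M : Type*} [AddCommGroup M] [Module ℝ M] {k l : ℕ}
    (α : M [⋀^Fin k]→ₗ[ℝ] ℝ) (β : M [⋀^Fin l]→ₗ[ℝ] ℝ) : M [⋀^Fin (k + l)]→ₗ[ℝ] ℝ :=
  ((LinearMap.mul' ℝ ℝ).compAlternatingMap (α.domCoprod β)).domDomCongr finSumFinEquiv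

theorem wedge_add_left {M : Type*} [AddCommGroup M] [Module ℝ M] {k l : ℕ}
    (α α' : M [⋀^Fin k]→ₗ[ℝ] ℝ) (β : M [⋀^Fin l]→ₗ[ℝ] ℝ) :
    wedge (α + α') β = wedge α β + wedge α' β := by
  unfold wedge
  rw [← AlternatingMap.domCoprod'_apply, ← AlternatingMap.domCoprod'_apply,
    ← AlternatingMap.domCoprod'_apply, TensorProduct.add_tmul, map_add]
  ext v
  simp

theorem wedge_smul_left {M : Type*} [AddCommGroup M] [Module ℝ M] {k l : ℕ}
    (c : ℝ) (α : M [⋀^Fin k]→ₗ[ℝ] ℝ) (β : M [⋀^Fin l]→ₗ[ℝ] ℝ) :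
    wedge (c • α) β = c • wedge α β := by
  unfold wedge
  rw [← AlternatingMap.domCoprod'_apply, ← AlternatingMap.domCoprod'_apply,
    ← TensorProduct.smul_tmul', map_smul]
  ext v
  simp

/-- The model `ℝ⁶` of the tangent spaces of `M = ]a,b[ × G/K`.  At `γ_t = (t, eK)` it is
identified with `T_{γ_t} M` by means of the oriented basis
`B_t = (ξ, Â, Ê₁, V̂₁, Ê₂, V̂₂)`, whose members correspond, in this order, to the standard
basis vectors. -/
abbrev V6 : Type := Fin 6 → ℝ

/-- The standard basis of the model, that is, `B_t`. -/
def stdB : Fin 6 → V6 := fun i => Pi.single i 1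

/-- The dual coframe `B_t^* = (ξ^*, A^*, E₁^*, V₁^*, E₂^*, V₂^*)`, as `1`-forms. -/
def dx (i : Fin 6) : V6 [⋀^Fin 1]→ₗ[ℝ] ℝ :=
  AlternatingMap.ofSubsingleton ℝ V6 ℝ (0 : Fin 1) (LinearMap.proj i)

/-- The endomorphism `S_θ` of a `3`-form `θ`, with respect to the volume form
`τ = dx 0 ∧ ⋯ ∧ dx 5`: it is characterized by `(ι_v θ ∧ θ) ∧ α = α (S_θ v) τ` for all vectors `v`
and covectors `α`.  Evaluating on the basis, where `τ` equals `1`, and taking for `α` the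
`i`-th coordinate gives the `i`-th component of `S_θ v`. -/
def sEnd (θ : V6 [⋀^Fin 3]→ₗ[ℝ] ℝ) : V6 →ₗ[ℝ] V6 where
  toFun v := fun i => wedge (wedge (θ.curryLeft v) θ) (dx i) stdB
  map_add' v w := by
    ext i
    simp [map_add, wedge_add_left]
  map_smul' c v := by
    ext i
    simp [map_smul, wedge_smul_left]

/-- The invariant quartic `P`, determined by `S_θ ∘ S_θ = P(θ) Id` on a `6`-dimensional space. -/
def quartic (θ : V6 [⋀^Fin 3]→ₗ[ℝ] ℝ) : ℝ :=
  LinearMap.trace ℝ V6 (sEnd θ ∘ₗ sEnd θ) / 6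

/-- Stable `3`-forms: those with `P(θ) < 0`. -/
def IsStable (θ : V6 [⋀^Fin 3]→ₗ[ℝ] ℝ) : Prop := quartic θ < 0

/-- The complex structure `J_θ = S_θ / √(-P(θ))` of a stable `3`-form. -/
def jEnd (θ : V6 [⋀^Fin 3]→ₗ[ℝ] ℝ) : V6 →ₗ[ℝ] V6 :=
  (Real.sqrt (-quartic θ))⁻¹ • sEnd θ

/-- The `3`-form `J_θ^* θ = θ(J_θ ·, J_θ ·, J_θ ·)`. -/
def jPull (θ : V6 [⋀^Fin 3]→ₗ[ℝ] ℝ) : V6 [⋀^Fin 3]→ₗ[ℝ] ℝ :=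
  θ.compLinearMap (jEnd θ)

/-- Alternating forms on the finite-dimensional space `V6` are continuous. -/
theorem continuous_form {k : ℕ} (β : V6 [⋀^Fin k]→ₗ[ℝ] ℝ) :
    Continuous fun v : Fin k → V6 => β v := by
  classical
  have h : ∀ v : Fin k → V6, β v =
      ∑ r : Fin k → Fin 6, (∏ i, v i (r i)) • β fun i => stdB (r i) := by
    intro v
    have hv : v = fun i => ∑ j : Fin 6, v i j • stdB j := by
      funext i
      ext m
      simp only [stdB, Finset.sum_apply, Pi.smul_apply, Pi.single_apply, smul_eq_mul, mul_ite,
        mul_one, mul_zero, Finset.sum_ite_eq, Finset.mem_univ, if_true]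
    conv_lhs => rw [hv]
    change β.toMultilinearMap _ = _
    rw [MultilinearMap.map_sum]
    refine Finset.sum_congr rfl fun r _ => ?_
    exact MultilinearMap.map_smul_univ β.toMultilinearMap _ _
  rw [show (fun v : Fin k → V6 => β v) = _ from funext h]
  fun_prop

/-- An alternating form on `V6` as a continuous alternating form. -/
def toCont {k : ℕ} (β : V6 [⋀^Fin k]→ₗ[ℝ] ℝ) : V6 [⋀^Fin k]→L[ℝ] ℝ :=
  { β with cont := continuous_form β }

/-! ## The group and the manifold

`SU₂` is the group of unit quaternions and `su₂` is the space of imaginary quaternions with the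
commutator as bracket.  Write `G = SU₂ × SU₂` and let `K = {(exp (s H), exp (s H))}` be the diagonal
circle.  The manifold `M = ]a,b[ × G/K` is the base of the surjective submersion
`π : ]a,b[ × ℍˣ × ℍˣ → M`, `π (t, q₁, q₂) = (t, (q₁/|q₁|, q₂/|q₂|) K)`,
whose domain is an open subset of the vector space `ℝ × ℍ × ℍ`.  The pull-back by `π` is injective
on forms and commutes with `d`; forms on `M` are represented by their pull-backs. -/

/-- The generator `H` of a Cartan subalgebra of `su₂`. -/
def qH : ℍ[ℝ] := ⟨0, 1 / 2, 0, 0⟩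

/-- The vector `E`, orthogonal to `H`, with `B(E, E) = -1` for the Killing form `B` of `su₂`. -/
def qE : ℍ[ℝ] := ⟨0, 0, 1 / (2 * Real.sqrt 2), 0⟩

/-- The vector `V = [H, E]`. -/
def qV : ℍ[ℝ] := ⟨0, 0, 0, 1 / (2 * Real.sqrt 2)⟩

@[simp] theorem qH_re : qH.re = 0 := rfl
@[simp] theorem qH_imI : qH.imI = 1 / 2 := rfl
@[simp] theorem qH_imJ : qH.imJ = 0 := rfl
@[simp] theorem qH_imK : qH.imK = 0 := rfl
@[simp] theorem qE_re : qE.re = 0 := rfl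
@[simp] theorem qE_imI : qE.imI = 0 := rfl
@[simp] theorem qE_imJ : qE.imJ = 1 / (2 * Real.sqrt 2) := rfl
@[simp] theorem qE_imK : qE.imK = 0 := rfl
@[simp] theorem qV_re : qV.re = 0 := rfl
@[simp] theorem qV_imI : qV.imI = 0 := rfl
@[simp] theorem qV_imJ : qV.imJ = 0 := rfl
@[simp] theorem qV_imK : qV.imK = 1 / (2 * Real.sqrt 2) := rfl

theorem bracket_H_E : qH * qE - qE * qH = qV := by
  ext <;> simp <;> ring

theorem bracket_H_V : qH * qV - qV * qH = -qE := by
  ext <;> simp <;> ring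

theorem bracket_E_V : qE * qV - qV * qE = (1 / 2 : ℝ) • qH := by
  have h : (Real.sqrt 2)⁻¹ * (Real.sqrt 2)⁻¹ = 1 / 2 := by
    rw [← mul_inv, Real.mul_self_sqrt (by norm_num)]; norm_num
  ext <;> simp <;> nlinarith [h]

/-- The vector space containing the total space of `π`. -/
abbrev Amb : Type := ℝ × ℍ[ℝ] × ℍ[ℝ]

/-- The open interval `]a,b[`, possibly unbounded. -/
def openInterval (a b : EReal) : Set ℝ := {t | a < (t : EReal) ∧ (t : EReal) < b}

/-- The total space `]a,b[ × ℍˣ × ℍˣ` of `π`. -/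
def total (a b : EReal) : Set Amb := {u | u.1 ∈ openInterval a b ∧ u.2.1 ≠ 0 ∧ u.2.2 ≠ 0}

/-- The left-invariant coframe `(ξ^*, A^*, E₁^*, V₁^*, E₂^*, V₂^*)` at `u = (t, q₁, q₂)`.  The
imaginary part of `q⁻¹ w` is the Maurer--Cartan form of `SU₂`, pulled back to `ℍˣ` by `q ↦ q/|q|`;
its components are taken with respect to the basis `U = (H, H)`, `A = (H, -H)`, `E₁ = (E, 0)`,
`V₁ = (V, 0)`, `E₂ = (0, E)`, `V₂ = (0, V)` of `su₂ + su₂`, and the component along the isotropy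
algebra `ℝ U` is dropped.  So this is the differential `T_u → T_{π u} M` followed by the
identification of `T_{π u} M` with `T_{γ_t} M` (translation by the group element) and with `V6`. -/
def coframe (u : Amb) : Amb →ₗ[ℝ] V6 where
  toFun w := ![w.1,
    (u.2.1⁻¹ * w.2.1).imI - (u.2.2⁻¹ * w.2.2).imI,
    2 * Real.sqrt 2 * (u.2.1⁻¹ * w.2.1).imJ,
    2 * Real.sqrt 2 * (u.2.1⁻¹ * w.2.1).imK,
    2 * Real.sqrt 2 * (u.2.2⁻¹ * w.2.2).imJ,
    2 * Real.sqrt 2 * (u.2.2⁻¹ * w.2.2).imK]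
  map_add' v w := by
    ext i
    fin_cases i <;> (simp only [Prod.fst_add, Prod.snd_add, mul_add, Quaternion.imI_add,
      Quaternion.imJ_add, Quaternion.imK_add]; simp; try ring)
  map_smul' c w := by
    ext i
    fin_cases i <;> (simp only [Prod.smul_fst, Prod.smul_snd, mul_smul_comm, Quaternion.imI_smul,
      Quaternion.imJ_smul, Quaternion.imK_smul]; simp; try ring)

/-- The vector field `ξ = ∂/∂t`. -/
def xiField (_u : Amb) : Amb := (1, 0, 0)

/-- The fundamental vector field `X̂` of `X = (X₁, X₂) ∈ su₂ + su₂` for the left action of `G`. -/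
def actionField (X₁ X₂ : ℍ[ℝ]) (u : Amb) : Amb := (0, X₁ * u.2.1, X₂ * u.2.2)

/-- Along `γ_t`, the coframe sends `ξ, Â, Ê₁, V̂₁, Ê₂, V̂₂` to the standard basis, and `Û` to `0`. -/
theorem coframe_along_gamma (t : ℝ) :
    coframe (t, 1, 1) (xiField (t, 1, 1)) = stdB 0 ∧
    coframe (t, 1, 1) (actionField qH (-qH) (t, 1, 1)) = stdB 1 ∧
    coframe (t, 1, 1) (actionField qE 0 (t, 1, 1)) = stdB 2 ∧
    coframe (t, 1, 1) (actionField qV 0 (t, 1, 1)) = stdB 3 ∧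
    coframe (t, 1, 1) (actionField 0 qE (t, 1, 1)) = stdB 4 ∧
    coframe (t, 1, 1) (actionField 0 qV (t, 1, 1)) = stdB 5 ∧
    coframe (t, 1, 1) (actionField qH qH (t, 1, 1)) = 0 := by
  have h : Real.sqrt 2 ≠ 0 := by positivity
  refine ⟨?_, ?_, ?_, ?_, ?_, ?_, ?_⟩ <;> ext i <;> fin_cases i <;>
    simp [coframe, xiField, actionField, stdB] <;> field_simp <;> norm_num

/-- The coframe is invariant under the left action of `G` (and even of `ℍˣ × ℍˣ`). -/
theorem coframe_left_invariant (g₁ g₂ : ℍ[ℝ]) (h₁ : g₁ ≠ 0) (h₂ : g₂ ≠ 0) (u w : Amb) :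
    coframe (u.1, g₁ * u.2.1, g₂ * u.2.2) (w.1, g₁ * w.2.1, g₂ * w.2.2) = coframe u w := by
  have e : ∀ g q x : ℍ[ℝ], g ≠ 0 → (g * q)⁻¹ * (g * x) = q⁻¹ * x := by
    intro g q x hg
    rw [mul_inv_rev, mul_assoc, inv_mul_cancel_left₀ hg]
  simp only [coframe, LinearMap.coe_mk, AddHom.coe_mk, e _ _ _ h₁, e _ _ _ h₂]

/-- The kernel of the coframe is the tangent space of the fibre of `π`, spanned by the radial
directions of the two factors `ℍˣ` and by the direction of the right action of `K`. -/
theorem coframe_eq_zero_iff (u w : Amb) (h₁ : u.2.1 ≠ 0) (h₂ : u.2.2 ≠ 0) :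
    coframe u w = 0 ↔ ∃ r₁ r₂ s : ℝ,
      w = (0, u.2.1 * ((r₁ : ℍ[ℝ]) + s • qH), u.2.2 * ((r₂ : ℍ[ℝ]) + s • qH)) := by
  have hs : Real.sqrt 2 ≠ 0 := by positivity
  constructor
  · intro h
    have h0 := congrFun h 0
    have h1 := congrFun h 1
    have h2 := congrFun h 2
    have h3 := congrFun h 3
    have h4 := congrFun h 4
    have h5 := congrFun h 5
    simp only [coframe, LinearMap.coe_mk, AddHom.coe_mk, Pi.zero_apply, Matrix.cons_val] at h0 h1 h2 h3 h4 h5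
    have hJ₁ := (mul_eq_zero.mp h2).resolve_left (by positivity)
    have hK₁ := (mul_eq_zero.mp h3).resolve_left (by positivity)
    have hJ₂ := (mul_eq_zero.mp h4).resolve_left (by positivity)
    have hK₂ := (mul_eq_zero.mp h5).resolve_left (by positivity)
    refine ⟨(u.2.1⁻¹ * w.2.1).re, (u.2.2⁻¹ * w.2.2).re, 2 * (u.2.1⁻¹ * w.2.1).imI, ?_⟩
    have e₁ : ((u.2.1⁻¹ * w.2.1).re : ℍ[ℝ]) + (2 * (u.2.1⁻¹ * w.2.1).imI) • qH =
        u.2.1⁻¹ * w.2.1 := by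
      ext
      · simp
      · simp; ring
      · rw [hJ₁]; simp
      · rw [hK₁]; simp
    have e₂ : ((u.2.2⁻¹ * w.2.2).re : ℍ[ℝ]) + (2 * (u.2.1⁻¹ * w.2.1).imI) • qH =
        u.2.2⁻¹ * w.2.2 := by
      rw [sub_eq_zero.mp h1]
      ext
      · simp
      · simp; ring
      · rw [hJ₂]; simp
      · rw [hK₂]; simp
    rw [e₁, e₂, mul_inv_cancel_left₀ h₁, mul_inv_cancel_left₀ h₂]
    exact Prod.ext h0 rfl
  · rintro ⟨r₁, r₂, s, rfl⟩
    ext i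
    simp only [coframe, LinearMap.coe_mk, AddHom.coe_mk, inv_mul_cancel_left₀ h₁,
      inv_mul_cancel_left₀ h₂]
    fin_cases i <;> simp

/-- The pull-back to the total space of `π` of the `G`-invariant form on `M` whose value at `γ_t` is
the `K`-invariant form `β t`. -/
def invForm {k : ℕ} (β : ℝ → V6 [⋀^Fin k]→ₗ[ℝ] ℝ) (u : Amb) : Amb [⋀^Fin k]→L[ℝ] ℝ :=
  (toCont (β u.1)).compContinuousLinearMap (LinearMap.toContinuousLinearMap (coframe u))

/-! ## The invariant forms and the conditions -/

/-- `ω¹ = ξ^* ∧ A^*`. -/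
def om1 : V6 [⋀^Fin 2]→ₗ[ℝ] ℝ := wedge (dx 0) (dx 1)
/-- `ω² = E₁^* ∧ V₁^*`. -/
def om2 : V6 [⋀^Fin 2]→ₗ[ℝ] ℝ := wedge (dx 2) (dx 3)
/-- `ω³ = E₂^* ∧ V₂^*`. -/
def om3 : V6 [⋀^Fin 2]→ₗ[ℝ] ℝ := wedge (dx 4) (dx 5)
/-- `ω⁴ = E₁^* ∧ E₂^* + V₁^* ∧ V₂^*`. -/
def om4 : V6 [⋀^Fin 2]→ₗ[ℝ] ℝ := wedge (dx 2) (dx 4) + wedge (dx 3) (dx 5)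
/-- `ω⁵ = E₁^* ∧ V₂^* - V₁^* ∧ E₂^*`. -/
def om5 : V6 [⋀^Fin 2]→ₗ[ℝ] ℝ := wedge (dx 2) (dx 5) - wedge (dx 3) (dx 4)

/-- `ψ^{1i} = ξ^* ∧ ωⁱ`. -/
def psi1 (β : V6 [⋀^Fin 2]→ₗ[ℝ] ℝ) : V6 [⋀^Fin 3]→ₗ[ℝ] ℝ := wedge (dx 0) β
/-- `ψ^{2i} = A^* ∧ ωⁱ`. -/
def psi2 (β : V6 [⋀^Fin 2]→ₗ[ℝ] ℝ) : V6 [⋀^Fin 3]→ₗ[ℝ] ℝ := wedge (dx 1) β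

/-- The values along `γ_t` of the invariant `2`-form `ω = ∑ fᵢ ωⁱ`. -/
def omegaForm (f₁ f₂ f₃ f₄ f₅ : ℝ → ℝ) (t : ℝ) : V6 [⋀^Fin 2]→ₗ[ℝ] ℝ :=
  f₁ t • om1 + f₂ t • om2 + f₃ t • om3 + f₄ t • om4 + f₅ t • om5

/-- The values along `γ_t` of the invariant `3`-form `ψ = ∑ p_{aj} ψ^{aj}`. -/
def psiForm (p₁₂ p₁₃ p₁₄ p₁₅ p₂₂ p₂₃ p₂₄ p₂₅ : ℝ → ℝ) (t : ℝ) : V6 [⋀^Fin 3]→ₗ[ℝ] ℝ :=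
  p₁₂ t • psi1 om2 + p₁₃ t • psi1 om3 + p₁₄ t • psi1 om4 + p₁₅ t • psi1 om5 +
    p₂₂ t • psi2 om2 + p₂₃ t • psi2 om3 + p₂₄ t • psi2 om4 + p₂₅ t • psi2 om5

/-- The bilinear form `g = ω(·, J_θ ·)`. -/
def metric (om : V6 [⋀^Fin 2]→ₗ[ℝ] ℝ) (θ : V6 [⋀^Fin 3]→ₗ[ℝ] ℝ) (v w : V6) : ℝ :=
  om ![v, jEnd θ w]

/-- The Reyes Carrión--Hitchin conditions, with constant `μ`, on the invariant forms on `M` with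
values `om t` and `ps t` along `γ_t`, except for the definiteness of `g`: `ψ` is stable, `ω` is
`J_ψ`-invariant, `dω = 3 ψ` and `d (J_ψ^* ψ) = -2 μ ω ∧ ω`. -/
structure ReyesCarrionHitchin (a b : EReal) (μ : ℝ) (om : ℝ → V6 [⋀^Fin 2]→ₗ[ℝ] ℝ)
    (ps : ℝ → V6 [⋀^Fin 3]→ₗ[ℝ] ℝ) : Prop where
  stable : ∀ t ∈ openInterval a b, IsStable (ps t)
  invariant : ∀ t ∈ openInterval a b, ∀ v w : V6,
    om t ![jEnd (ps t) v, jEnd (ps t) w] = om t ![v, w]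
  d_omega : ∀ u ∈ total a b, extDeriv (invForm om) u = (3 : ℝ) • invForm ps u
  d_psi_hat : ∀ u ∈ total a b, extDeriv (invForm fun t => jPull (ps t)) u =
    (-2 * μ) • invForm (fun t => wedge (om t) (om t)) u

/-- The normalization `g(ξ, ξ) = 1` and `g(ξ, X̂) = 0` for all `X ∈ su₂ + su₂`, at all points of
`M`. -/
def Normalized (a b : EReal) (om : ℝ → V6 [⋀^Fin 2]→ₗ[ℝ] ℝ)
    (ps : ℝ → V6 [⋀^Fin 3]→ₗ[ℝ] ℝ) : Prop :=
  ∀ u ∈ total a b,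
    metric (om u.1) (ps u.1) (coframe u (xiField u)) (coframe u (xiField u)) = 1 ∧
    ∀ X₁ X₂ : ℍ[ℝ], X₁.re = 0 → X₂.re = 0 →
      metric (om u.1) (ps u.1) (coframe u (xiField u)) (coframe u (actionField X₁ X₂ u)) = 0

/-- The coefficients of `ψ` are those of `dω / 3`. -/
structure PsiCoefficients (a b : EReal)
    (f₁ f₂ f₃ f₄ f₅ p₁₂ p₁₃ p₁₄ p₁₅ p₂₂ p₂₃ p₂₄ p₂₅ : ℝ → ℝ) : Prop where
  h22 : ∀ t ∈ openInterval a b, p₂₂ t = 0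
  h23 : ∀ t ∈ openInterval a b, p₂₃ t = 0
  h12 : ∀ t ∈ openInterval a b, p₁₂ t = deriv f₂ t / 3 + f₁ t / 12
  h13 : ∀ t ∈ openInterval a b, p₁₃ t = deriv f₃ t / 3 - f₁ t / 12
  h14 : ∀ t ∈ openInterval a b, p₁₄ t = deriv f₄ t / 3
  h15 : ∀ t ∈ openInterval a b, p₁₅ t = deriv f₅ t / 3
  h24 : ∀ t ∈ openInterval a b, p₂₄ t = 2 / 3 * f₅ t
  h25 : ∀ t ∈ openInterval a b, p₂₅ t = -(2 / 3) * f₄ t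

/-- The differential system for `(f₁, f₂, f₃, F)`. -/
structure DiffSystem (a b : EReal) (μ : ℝ) (f₁ f₂ f₃ F : ℝ → ℝ) : Prop where
  eq1 : ∀ t ∈ openInterval a b,
    deriv (fun s => (deriv f₂ s + 1 / 4 * f₁ s) * f₁ s) t + 12 * μ * f₁ t * f₂ t = 0
  eq2 : ∀ t ∈ openInterval a b,
    deriv (fun s => (deriv f₃ s - 1 / 4 * f₁ s) * f₁ s) t + 12 * μ * f₁ t * f₃ t = 0
  eq3 : ∀ t ∈ openInterval a b,
    deriv (fun s => deriv F s * f₁ s) t - 4 * (F t / f₁ t) + 12 * μ * f₁ t * F t = 0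
  eq4 : ∀ t ∈ openInterval a b,
    f₁ t * (deriv f₂ t - deriv f₃ t + 1 / 2 * f₁ t) + 48 * μ * (f₂ t * f₃ t - F t ^ 2) = 0

end NearlyKahler

end

noncomputable section

namespace NearlyKahler

/-! Everything is invariant, so each condition in (I) becomes an identity between coefficients at
the model space. Write a = (a₂,…,a₅) for the ξ-coefficients of ψ, b = (b₂,…,b₅) for the
A-coefficients, N = a₂a₃ - a₄² - a₅² and B = b₄² + b₅².

The equation dω = 3ψ is exactly the list of coefficients in (II); in particular b₂ = b₃ = 0. For
such ψ the endomorphism S is explicit (`sEnd_psiVal`), preserves the plane of ξ and A, and satisfies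
S² = P with P = 4((a₄b₄ + a₅b₅)² + NB). The condition g(ξ, A) = 0 is a₄b₄ + a₅b₅ = 0, that is f₄'f₅
= f₅'f₄: the curve (f₄, f₅) stays on a ray, which produces θ₀ and F (`exists_polar_angle`). Then P =
4NB, stability means N < 0 < B, and g(ξ, ξ) = 1 becomes f₁ < 0 together with f₁²N = -B
(`normalization`). In terms of F these are condition (ii) and the algebraic relation in (II), at
every t. The same relation removes the square root from J*ψ (`jPull_psiVal`), and d(J*ψ) = -2μ ω∧ω
turns into the differential system (`extDeriv_jPull_iff_diffSystem`).

Conversely, the algebraic relation is assumed at a single t₀ and must be propagated. Differentiating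
the fourth equation and substituting the first two gives ω∧ψ = 0, which is also what the
J-invariance of ω requires. With this identity the left side of the algebraic relation has zero
derivative, so it is a first integral (`first_integral`) and vanishes on the whole interval. The
normalization can then be read backwards (`normalization_converse`). -/

/-! ### Wedge products on ℝ⁶ through monomial forms. -/

/-- The product of the coordinates `I 0, I 1, …` of the successive arguments. -/
def monoMul {k : ℕ} (I : Fin k → Fin 6) : MultilinearMap ℝ (fun _ : Fin k => V6) ℝ :=
  (MultilinearMap.mkPiAlgebra ℝ (Fin k) ℝ).compLinearMap fun i => LinearMap.proj (I i)

/-- The monomial form `dx (I 0) ∧ dx (I 1) ∧ ⋯`. -/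
def mono {k : ℕ} (I : Fin k → Fin 6) : V6 [⋀^Fin k]→ₗ[ℝ] ℝ :=
  MultilinearMap.alternatization (monoMul I)

theorem monoMul_apply {k : ℕ} (I : Fin k → Fin 6) (v : Fin k → V6) :
    monoMul I v = ∏ i, v i (I i) := by
  simp [monoMul]

theorem mono_apply {k : ℕ} (I : Fin k → Fin 6) (v : Fin k → V6) :
    mono I v = Matrix.det (Matrix.of fun i j => v i (I j)) := by
  simp only [mono, MultilinearMap.alternatization_apply, Matrix.det_apply,
    MultilinearMap.domDomCongr_apply, monoMul_apply, Matrix.of_apply]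

theorem wedge_add_right {M : Type*} [AddCommGroup M] [Module ℝ M] {k l : ℕ}
    (α : M [⋀^Fin k]→ₗ[ℝ] ℝ) (β β' : M [⋀^Fin l]→ₗ[ℝ] ℝ) :
    wedge α (β + β') = wedge α β + wedge α β' := by
  unfold wedge
  rw [← AlternatingMap.domCoprod'_apply, ← AlternatingMap.domCoprod'_apply,
    ← AlternatingMap.domCoprod'_apply, TensorProduct.tmul_add, map_add]
  ext v
  simp

theorem wedge_smul_right {M : Type*} [AddCommGroup M] [Module ℝ M] {k l : ℕ}
    (c : ℝ) (α : M [⋀^Fin k]→ₗ[ℝ] ℝ) (β : M [⋀^Fin l]→ₗ[ℝ] ℝ) :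
    wedge α (c • β) = c • wedge α β := by
  unfold wedge
  rw [← AlternatingMap.domCoprod'_apply, ← AlternatingMap.domCoprod'_apply,
    TensorProduct.tmul_smul, map_smul]
  ext v
  simp

/-- The wedge of two alternatizations is the alternatization of the plain product, and the product
of two coordinate monomials is the monomial of the concatenated index list. -/
theorem wedge_mono {k l : ℕ} (I : Fin k → Fin 6) (J : Fin l → Fin 6) :
    wedge (mono I) (mono J) = mono (Fin.append I J) := by
  unfold wedge mono
  rw [← MultilinearMap.domCoprod_alternization, ← LinearMap.compMultilinearMap_alternatization]
  have h : monoMul (Fin.append I J) = ((LinearMap.mul' ℝ ℝ).compMultilinearMap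
      ((monoMul I).domCoprod (monoMul J))).domDomCongr finSumFinEquiv := by
    ext v
    simp [monoMul_apply, Fin.prod_univ_add]
  ext v
  rw [h, AlternatingMap.domDomCongr_apply, MultilinearMap.alternatization_apply,
    MultilinearMap.alternatization_apply]
  refine Fintype.sum_equiv (finSumFinEquiv.permCongr) _ _ fun σ => ?_
  simp [Function.comp_def]

/-- Alternating forms on `V6` are combinations of monomial forms. -/
theorem form_induction {k : ℕ} {motive : (V6 [⋀^Fin k]→ₗ[ℝ] ℝ) → Prop}
    (mono : ∀ I, motive (mono I)) (add : ∀ α β, motive α → motive β → motive (α + β))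
    (smul : ∀ (c : ℝ) α, motive α → motive (c • α)) (β : V6 [⋀^Fin k]→ₗ[ℝ] ℝ) : motive β := by
  have h : (β : MultilinearMap ℝ (fun _ : Fin k => V6) ℝ) =
      ∑ r : Fin k → Fin 6, β (fun i => stdB (r i)) • monoMul r := by
    refine MultilinearMap.ext fun v => ?_
    have hv : v = fun i => ∑ j : Fin 6, v i j • stdB j := by
      funext i
      ext m
      simp only [stdB, Finset.sum_apply, Pi.smul_apply, Pi.single_apply, smul_eq_mul, mul_ite,
        mul_one, mul_zero, Finset.sum_ite_eq, Finset.mem_univ, if_true]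
    conv_lhs => rw [hv]
    rw [MultilinearMap.map_sum, sum_apply]
    refine Finset.sum_congr rfl fun r _ => ?_
    rw [MultilinearMap.map_smul_univ, smul_apply, monoMul_apply, smul_eq_mul,
      smul_eq_mul, mul_comm]
    rfl
  -- Alternatizing the alternating form β multiplies it by k!, so alternatizing the multilinear
  -- expansion `h` and dividing by k! expands β in monomial forms.
  have h2 : β = (k.factorial : ℝ)⁻¹ • ∑ r : Fin k → Fin 6,
      β (fun i => stdB (r i)) • NearlyKahler.mono r := by
    have := AlternatingMap.coe_alternatization β
    rw [h, map_sum] at this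
    simp only [Fintype.card_fin] at this
    rw [eq_inv_smul_iff₀ (by positivity), Nat.cast_smul_eq_nsmul, ← this]
    refine Finset.sum_congr rfl fun r _ => ?_
    ext v
    simp [NearlyKahler.mono, MultilinearMap.alternatization_apply, Finset.mul_sum, mul_smul_comm]
  rw [h2]
  refine smul _ _ (Finset.sum_induction _ motive add ?_ fun r _ => smul _ _ (mono r))
  have := smul 0 _ (mono fun _ => 0)
  rwa [zero_smul] at this

/-- This and the next three shuffle formulas are bilinear in (α, β), so monomial forms suffice;
there each one is a Laplace expansion of a determinant. -/
theorem wedge_one_one (α : V6 [⋀^Fin 1]→ₗ[ℝ] ℝ) (β : V6 [⋀^Fin 1]→ₗ[ℝ] ℝ) (x y : V6) :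
    wedge α β ![x,y] = α ![x] * β ![y] - α ![y] * β ![x] := by
  induction α using form_induction with
  | add γ γ' h h' => rw [wedge_add_left]; simp only [AlternatingMap.add_apply, h, h']; ring
  | smul c γ h => rw [wedge_smul_left]; simp only [AlternatingMap.smul_apply, smul_eq_mul, h]; ring
  | mono I =>
  induction β using form_induction with
  | add γ γ' h h' => rw [wedge_add_right]; simp only [AlternatingMap.add_apply, h, h']; ring
  | smul c γ h => rw [wedge_smul_right]; simp only [AlternatingMap.smul_apply, smul_eq_mul, h]; ring
  | mono J =>
  rw [wedge_mono]
  rw [show Fin.append I J = ![I 0, J 0] from by ext i; fin_cases i <;> rfl]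
  simp only [mono_apply, Matrix.det_succ_row_zero, Fin.sum_univ_succ, Fin.sum_univ_zero,
    Matrix.det_fin_zero]
  simp [Fin.succAbove]
  ring

theorem wedge_one_two (α : V6 [⋀^Fin 1]→ₗ[ℝ] ℝ) (β : V6 [⋀^Fin 2]→ₗ[ℝ] ℝ) (x y z : V6) :
    wedge α β ![x,y,z] = α ![x] * β ![y, z] - α ![y] * β ![x, z] + α ![z] * β ![x, y] := by
  induction α using form_induction with
  | add γ γ' h h' => rw [wedge_add_left]; simp only [AlternatingMap.add_apply, h, h']; ring
  | smul c γ h => rw [wedge_smul_left]; simp only [AlternatingMap.smul_apply, smul_eq_mul, h]; ring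
  | mono I =>
  induction β using form_induction with
  | add γ γ' h h' => rw [wedge_add_right]; simp only [AlternatingMap.add_apply, h, h']; ring
  | smul c γ h => rw [wedge_smul_right]; simp only [AlternatingMap.smul_apply, smul_eq_mul, h]; ring
  | mono J =>
  rw [wedge_mono]
  rw [show Fin.append I J = ![I 0, J 0, J 1] from by ext i; fin_cases i <;> rfl]
  simp only [mono_apply, Matrix.det_succ_row_zero, Fin.sum_univ_succ, Fin.sum_univ_zero,
    Matrix.det_fin_zero]
  simp [Fin.succAbove]
  ring

theorem wedge_two_two (α : V6 [⋀^Fin 2]→ₗ[ℝ] ℝ) (β : V6 [⋀^Fin 2]→ₗ[ℝ] ℝ) (x y z w : V6) :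
    wedge α β ![x, y, z, w] =
      α ![x, y] * β ![z, w] - α ![x, z] * β ![y, w] + α ![x, w] * β ![y, z] +
      α ![y, z] * β ![x, w] - α ![y, w] * β ![x, z] + α ![z, w] * β ![x, y] := by
  induction α using form_induction with
  | add γ γ' h h' => rw [wedge_add_left]; simp only [AlternatingMap.add_apply, h, h']; ring
  | smul c γ h => rw [wedge_smul_left]; simp only [AlternatingMap.smul_apply, smul_eq_mul, h]; ring
  | mono I =>
  induction β using form_induction with
  | add γ γ' h h' => rw [wedge_add_right]; simp only [AlternatingMap.add_apply, h, h']; ring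
  | smul c γ h => rw [wedge_smul_right]; simp only [AlternatingMap.smul_apply, smul_eq_mul, h]; ring
  | mono J =>
  rw [wedge_mono]
  rw [show Fin.append I J = ![I 0, I 1, J 0, J 1] from by ext i; fin_cases i <;> rfl]
  simp only [mono_apply, Matrix.det_succ_row_zero, Fin.sum_univ_succ, Fin.sum_univ_zero,
    Matrix.det_fin_zero]
  simp [Fin.succAbove]
  ring

theorem wedge_two_three (α : V6 [⋀^Fin 2]→ₗ[ℝ] ℝ) (β : V6 [⋀^Fin 3]→ₗ[ℝ] ℝ) (x y z w u : V6) :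
    wedge α β ![x, y, z, w, u] =
      α ![x, y] * β ![z, w, u] - α ![x, z] * β ![y, w, u] + α ![x, w] * β ![y, z, u] -
      α ![x, u] * β ![y, z, w] + α ![y, z] * β ![x, w, u] - α ![y, w] * β ![x, z, u] +
      α ![y, u] * β ![x, z, w] + α ![z, w] * β ![x, y, u] - α ![z, u] * β ![x, y, w] +
      α ![w, u] * β ![x, y, z] := by
  induction α using form_induction with
  | add γ γ' h h' => rw [wedge_add_left]; simp only [AlternatingMap.add_apply, h, h']; ring
  | smul c γ h => rw [wedge_smul_left]; simp only [AlternatingMap.smul_apply, smul_eq_mul, h]; ring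
  | mono I =>
  induction β using form_induction with
  | add γ γ' h h' => rw [wedge_add_right]; simp only [AlternatingMap.add_apply, h, h']; ring
  | smul c γ h => rw [wedge_smul_right]; simp only [AlternatingMap.smul_apply, smul_eq_mul, h]; ring
  | mono J =>
  rw [wedge_mono]
  rw [show Fin.append I J = ![I 0, I 1, J 0, J 1, J 2] from by ext i; fin_cases i <;> rfl]
  simp only [mono_apply, Matrix.det_succ_row_zero, Fin.sum_univ_succ, Fin.sum_univ_zero,
    Matrix.det_fin_zero]
  simp [Fin.succAbove]
  ring

/-- Laplace expansion along the last column, which on the standard basis has its only nonzero entry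
in row i. The sign (-1)^(i+5) equals (-1)^(i+1). -/
theorem wedge_dx (α : V6 [⋀^Fin (2 + 3)]→ₗ[ℝ] ℝ) (i : Fin 6) :
    wedge α (dx i) stdB = (-1) ^ (i.val + 1) * α (i.removeNth stdB) := by
  have hdx : dx i = mono ![i] := by
    ext v
    rw [mono_apply]
    simp [dx]
  induction α using form_induction with
  | add γ γ' h h' => rw [wedge_add_left]; simp only [AlternatingMap.add_apply, h, h']; ring
  | smul c γ h => rw [wedge_smul_left]; simp only [AlternatingMap.smul_apply, smul_eq_mul, h]; ring
  | mono I =>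
  rw [hdx, wedge_mono]
  have h : Fin.append I ![i] = (Fin.snoc I i : Fin 6 → Fin 6) := Fin.append_right_eq_snoc _ _
  rw [h, mono_apply, mono_apply]
  refine (Matrix.det_succ_column (n := 5) _ (Fin.last 5)).trans ?_
  have hl : (Fin.snoc I i : Fin 6 → Fin 6) (Fin.last 5) = i := Fin.snoc_last _ _
  have hc : ∀ j, (Fin.snoc I i : Fin 6 → Fin 6) ((Fin.last 5).succAbove j) = I j := fun j => by
    rw [Fin.succAbove_last, Fin.snoc_castSucc]
  rw [Finset.sum_eq_single i]
  · have hm : (Matrix.of fun a b => stdB a ((Fin.snoc I i : Fin 6 → Fin 6) b)).submatrix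
        i.succAbove (Fin.last 5).succAbove = Matrix.of fun a b => i.removeNth stdB a (I b) := by
      ext a b
      simp only [Matrix.submatrix_apply, Matrix.of_apply, hc, Fin.removeNth]
    rw [hm, Matrix.of_apply, hl, Fin.val_last]
    simp [stdB, pow_add]
    ring
  · intro b _ hb
    rw [Matrix.of_apply, hl]
    simp [stdB, hb.symm]
  · simp

/-! ### The basic invariant forms in coordinates. -/

theorem dx_apply (i : Fin 6) (x : V6) : dx i ![x] = x i := by
  simp [dx]

theorem om1_apply (x y : V6) : om1 ![x, y] = x 0 * y 1 - y 0 * x 1 := by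
  simp only [om1, wedge_one_one, dx_apply]

theorem om2_apply (x y : V6) : om2 ![x, y] = x 2 * y 3 - y 2 * x 3 := by
  simp only [om2, wedge_one_one, dx_apply]

theorem om3_apply (x y : V6) : om3 ![x, y] = x 4 * y 5 - y 4 * x 5 := by
  simp only [om3, wedge_one_one, dx_apply]

theorem om4_apply (x y : V6) :
    om4 ![x, y] = x 2 * y 4 - y 2 * x 4 + (x 3 * y 5 - y 3 * x 5) := by
  simp only [om4, wedge_one_one, dx_apply, AlternatingMap.add_apply]

theorem om5_apply (x y : V6) :
    om5 ![x, y] = x 2 * y 5 - y 2 * x 5 - (x 3 * y 4 - y 3 * x 4) := by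
  simp only [om5, wedge_one_one, dx_apply, AlternatingMap.sub_apply]

theorem psi1_apply (β : V6 [⋀^Fin 2]→ₗ[ℝ] ℝ) (x y z : V6) :
    psi1 β ![x, y, z] = x 0 * β ![y, z] - y 0 * β ![x, z] + z 0 * β ![x, y] := by
  simp only [psi1, wedge_one_two, dx_apply]

theorem psi2_apply (β : V6 [⋀^Fin 2]→ₗ[ℝ] ℝ) (x y z : V6) :
    psi2 β ![x, y, z] = x 1 * β ![y, z] - y 1 * β ![x, z] + z 1 * β ![x, y] := by
  simp only [psi2, wedge_one_two, dx_apply]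

/-- The combination of the `ωⁱ` with constant coefficients. -/
def omegaVal (c₁ c₂ c₃ c₄ c₅ : ℝ) : V6 [⋀^Fin 2]→ₗ[ℝ] ℝ :=
  c₁ • om1 + c₂ • om2 + c₃ • om3 + c₄ • om4 + c₅ • om5

/-- The combination of the `ψ^{ai}` with constant coefficients. -/
def psiVal (a₂ a₃ a₄ a₅ b₂ b₃ b₄ b₅ : ℝ) : V6 [⋀^Fin 3]→ₗ[ℝ] ℝ :=
  a₂ • psi1 om2 + a₃ • psi1 om3 + a₄ • psi1 om4 + a₅ • psi1 om5 +
    b₂ • psi2 om2 + b₃ • psi2 om3 + b₄ • psi2 om4 + b₅ • psi2 om5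

theorem omegaVal_apply (c₁ c₂ c₃ c₄ c₅ : ℝ) (x y : V6) :
    omegaVal c₁ c₂ c₃ c₄ c₅ ![x, y] = c₁ * (x 0 * y 1 - y 0 * x 1) +
      c₂ * (x 2 * y 3 - y 2 * x 3) + c₃ * (x 4 * y 5 - y 4 * x 5) +
      c₄ * (x 2 * y 4 - y 2 * x 4 + (x 3 * y 5 - y 3 * x 5)) +
      c₅ * (x 2 * y 5 - y 2 * x 5 - (x 3 * y 4 - y 3 * x 4)) := by
  simp only [omegaVal, AlternatingMap.add_apply, AlternatingMap.smul_apply, smul_eq_mul,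
    om1_apply, om2_apply, om3_apply, om4_apply, om5_apply]

theorem psiVal_apply (a₂ a₃ a₄ a₅ b₂ b₃ b₄ b₅ : ℝ) (x y z : V6) :
    psiVal a₂ a₃ a₄ a₅ b₂ b₃ b₄ b₅ ![x, y, z] =
      x 0 * omegaVal 0 a₂ a₃ a₄ a₅ ![y, z] - y 0 * omegaVal 0 a₂ a₃ a₄ a₅ ![x, z] +
        z 0 * omegaVal 0 a₂ a₃ a₄ a₅ ![x, y] +
      (x 1 * omegaVal 0 b₂ b₃ b₄ b₅ ![y, z] - y 1 * omegaVal 0 b₂ b₃ b₄ b₅ ![x, z] +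
        z 1 * omegaVal 0 b₂ b₃ b₄ b₅ ![x, y]) := by
  simp only [psiVal, omegaVal, AlternatingMap.add_apply, AlternatingMap.smul_apply, smul_eq_mul,
    psi1_apply, psi2_apply]
  ring

/-! ### The endomorphism S, the complex structure J and the 3-form J*ψ. -/

theorem eq_vec_three {X : Type*} (g : Fin 3 → X) : g = ![g 0, g 1, g 2] := by
  funext j
  fin_cases j <;> rfl

theorem eq_vec_four {X : Type*} (g : Fin 4 → X) : g = ![g 0, g 1, g 2, g 3] := by
  funext j
  fin_cases j <;> rfl

theorem eq_vec_five {X : Type*} (g : Fin 5 → X) : g = ![g 0, g 1, g 2, g 3, g 4] := by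
  funext j
  fin_cases j <;> rfl

theorem sEnd_apply (θ : V6 [⋀^Fin 3]→ₗ[ℝ] ℝ) (v : V6) (i : Fin 6) :
    sEnd θ v i = (-1) ^ (i.val + 1) * wedge (θ.curryLeft v) θ
      ![stdB (i.succAbove 0), stdB (i.succAbove 1), stdB (i.succAbove 2), stdB (i.succAbove 3),
      stdB (i.succAbove 4)] := by
  have h := eq_vec_five (i.removeNth stdB)
  simp only [Fin.removeNth] at h
  simp only [sEnd, LinearMap.coe_mk, AddHom.coe_mk]
  rw [wedge_dx, h]

/-- The two zero coefficients are those forced by dω = 3ψ. The plane of ξ and A and the span of the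
other four basis vectors are both preserved. -/
theorem sEnd_psiVal (a₂ a₃ a₄ a₅ b₄ b₅ : ℝ) (v : V6) :
    sEnd (psiVal a₂ a₃ a₄ a₅ 0 0 b₄ b₅) v = ![
      2 * ((a₄ * b₄ + a₅ * b₅) * v 0 + (b₄ ^ 2 + b₅ ^ 2) * v 1),
      2 * ((a₂ * a₃ - a₄ ^ 2 - a₅ ^ 2) * v 0 - (a₄ * b₄ + a₅ * b₅) * v 1),
      2 * ((a₄ * b₅ - a₅ * b₄) * v 3 + a₃ * b₅ * v 4 - a₃ * b₄ * v 5),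
      2 * ((a₅ * b₄ - a₄ * b₅) * v 2 + a₃ * b₄ * v 4 + a₃ * b₅ * v 5),
      2 * (a₂ * b₅ * v 2 + a₂ * b₄ * v 3 + (a₅ * b₄ - a₄ * b₅) * v 5),
      2 * (-(a₂ * b₄ * v 2) + a₂ * b₅ * v 3 + (a₄ * b₅ - a₅ * b₄) * v 4)] := by
  have hs : ∀ i j, stdB i j = if i = j then 1 else 0 := fun i j => by
    simp [stdB, Pi.single_apply, eq_comm]
  ext i
  rw [sEnd_apply, wedge_two_three]
  simp only [AlternatingMap.curryLeft_apply_apply]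
  fin_cases i <;> simp [psiVal_apply, omegaVal_apply, hs, Fin.succAbove] <;> ring

theorem sEnd_sEnd_psiVal (a₂ a₃ a₄ a₅ b₄ b₅ : ℝ) (v : V6) :
    sEnd (psiVal a₂ a₃ a₄ a₅ 0 0 b₄ b₅) (sEnd (psiVal a₂ a₃ a₄ a₅ 0 0 b₄ b₅) v) =
      (4 * ((a₄ * b₄ + a₅ * b₅) ^ 2 + (a₂ * a₃ - a₄ ^ 2 - a₅ ^ 2) * (b₄ ^ 2 + b₅ ^ 2))) • v := by
  ext i
  rw [sEnd_psiVal, sEnd_psiVal]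
  fin_cases i <;> simp <;> ring

theorem quartic_psiVal (a₂ a₃ a₄ a₅ b₄ b₅ : ℝ) :
    quartic (psiVal a₂ a₃ a₄ a₅ 0 0 b₄ b₅) =
      4 * ((a₄ * b₄ + a₅ * b₅) ^ 2 + (a₂ * a₃ - a₄ ^ 2 - a₅ ^ 2) * (b₄ ^ 2 + b₅ ^ 2)) := by
  rw [quartic, show sEnd (psiVal a₂ a₃ a₄ a₅ 0 0 b₄ b₅) ∘ₗ sEnd (psiVal a₂ a₃ a₄ a₅ 0 0 b₄ b₅) =
    (4 * ((a₄ * b₄ + a₅ * b₅) ^ 2 + (a₂ * a₃ - a₄ ^ 2 - a₅ ^ 2) * (b₄ ^ 2 + b₅ ^ 2))) •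
      LinearMap.id from LinearMap.ext fun v => by simp [sEnd_sEnd_psiVal]]
  rw [map_smul, LinearMap.trace_id]
  simp

/-- With N and B as above, α = ∑ aⱼωʲ and β = b₄ω⁴ + b₅ω⁵, the form θ(S·,·,·) is 2N ξ*∧β + 2B A*∧α.
The point is that it is again alternating. -/
theorem psiVal_sEnd (a₂ a₃ a₄ a₅ b₄ b₅ : ℝ) (h : a₄ * b₄ + a₅ * b₅ = 0) (x y z : V6) :
    psiVal a₂ a₃ a₄ a₅ 0 0 b₄ b₅ ![sEnd (psiVal a₂ a₃ a₄ a₅ 0 0 b₄ b₅) x, y, z] =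
      2 * (a₂ * a₃ - a₄ ^ 2 - a₅ ^ 2) * psiVal 0 0 b₄ b₅ 0 0 0 0 ![x, y, z] +
      2 * (b₄ ^ 2 + b₅ ^ 2) * psiVal 0 0 0 0 a₂ a₃ a₄ a₅ ![x, y, z] := by
  rw [sEnd_psiVal]
  simp only [psiVal_apply, omegaVal_apply, Matrix.cons_val]
  have e : 2 * (psiVal a₂ a₃ a₄ a₅ 0 0 0 0 ![x, y, z] -
    psiVal 0 0 0 0 0 0 b₄ b₅ ![x, y, z]) * (a₄ * b₄ + a₅ * b₅) = 0 := by rw [h, mul_zero]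
  simp only [psiVal_apply, omegaVal_apply] at e
  linear_combination e

/-- Since θ(S·,·,·) is alternating, S may be moved from one slot to another; two of the three copies
are gathered in one slot and collapse by S² = P. -/
theorem psiVal_sEnd_triple (a₂ a₃ a₄ a₅ b₄ b₅ : ℝ) (h : a₄ * b₄ + a₅ * b₅ = 0) (x y z : V6) :
    psiVal a₂ a₃ a₄ a₅ 0 0 b₄ b₅ ![sEnd (psiVal a₂ a₃ a₄ a₅ 0 0 b₄ b₅) x,
      sEnd (psiVal a₂ a₃ a₄ a₅ 0 0 b₄ b₅) y, sEnd (psiVal a₂ a₃ a₄ a₅ 0 0 b₄ b₅) z] =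
    quartic (psiVal a₂ a₃ a₄ a₅ 0 0 b₄ b₅) *
      psiVal a₂ a₃ a₄ a₅ 0 0 b₄ b₅ ![sEnd (psiVal a₂ a₃ a₄ a₅ 0 0 b₄ b₅) x, y, z] := by
  set θ := psiVal a₂ a₃ a₄ a₅ 0 0 b₄ b₅ with hθ
  have hS : ∀ v, sEnd θ (sEnd θ v) = quartic θ • v := fun v => by
    rw [hθ, sEnd_sEnd_psiVal, quartic_psiVal]
  have swap₁ : ∀ x y z, θ ![x, y, z] = -θ ![y, x, z] := fun x y z => by
    simp only [hθ, psiVal_apply, omegaVal_apply]; ring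
  have swap₂ : ∀ x y z, θ ![x, y, z] = -θ ![z, y, x] := fun x y z => by
    simp only [hθ, psiVal_apply, omegaVal_apply]; ring
  have move₁ : ∀ x y z, θ ![x, sEnd θ y, z] = θ ![sEnd θ x, y, z] := fun x y z => by
    rw [swap₁, hθ, psiVal_sEnd _ _ _ _ _ _ h, psiVal_sEnd _ _ _ _ _ _ h]
    simp only [psiVal_apply, omegaVal_apply]; ring
  have move₂ : ∀ x y z, θ ![x, y, sEnd θ z] = θ ![sEnd θ x, y, z] := fun x y z => by
    rw [swap₂, hθ, psiVal_sEnd _ _ _ _ _ _ h, psiVal_sEnd _ _ _ _ _ _ h]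
    simp only [psiVal_apply, omegaVal_apply]; ring
  rw [move₂, move₁, hS]
  simp only [hθ, psiVal_apply, omegaVal_apply, Pi.smul_apply, smul_eq_mul]; ring

/-- The two hypotheses are the ξ- and A-components of ω∧ψ = 0, up to a constant factor; they make S
skew for ω. The J-invariance of ω then follows from S² = P. -/
theorem omegaVal_sEnd (f₁ f₂ f₃ f₄ f₅ a₂ a₃ a₄ a₅ b₄ b₅ : ℝ)
    (hα : f₂ * a₃ + f₃ * a₂ - 2 * (f₄ * a₄ + f₅ * a₅) = 0) (hβ : f₄ * b₄ + f₅ * b₅ = 0)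
    (x y : V6) :
    omegaVal f₁ f₂ f₃ f₄ f₅ ![sEnd (psiVal a₂ a₃ a₄ a₅ 0 0 b₄ b₅) x, y] =
      -omegaVal f₁ f₂ f₃ f₄ f₅ ![x, sEnd (psiVal a₂ a₃ a₄ a₅ 0 0 b₄ b₅) y] := by
  have e₁ : omegaVal 0 0 0 b₄ b₅ ![x, y] *
    (f₂ * a₃ + f₃ * a₂ - 2 * (f₄ * a₄ + f₅ * a₅)) = 0 := by rw [hα, mul_zero]
  have e₂ : omegaVal 0 a₂ a₃ a₄ a₅ ![x, y] * (f₄ * b₄ + f₅ * b₅) = 0 := by rw [hβ, mul_zero]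
  rw [sEnd_psiVal, sEnd_psiVal]
  simp only [omegaVal_apply, Matrix.cons_val] at e₁ e₂ ⊢
  linear_combination 2 * e₁ + 4 * e₂

theorem inv_sqrt_sq {θ : V6 [⋀^Fin 3]→ₗ[ℝ] ℝ} (h : IsStable θ) :
    (Real.sqrt (-quartic θ))⁻¹ ^ 2 * quartic θ = -1 := by
  have h' : quartic θ < 0 := h
  rw [inv_pow, Real.sq_sqrt (by linarith), inv_neg, neg_mul, inv_mul_cancel₀ h'.ne]

theorem omegaVal_jEnd (f₁ f₂ f₃ f₄ f₅ a₂ a₃ a₄ a₅ b₄ b₅ : ℝ)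
    (hα : f₂ * a₃ + f₃ * a₂ - 2 * (f₄ * a₄ + f₅ * a₅) = 0) (hβ : f₄ * b₄ + f₅ * b₅ = 0)
    (hst : IsStable (psiVal a₂ a₃ a₄ a₅ 0 0 b₄ b₅)) (x y : V6) :
    omegaVal f₁ f₂ f₃ f₄ f₅ ![jEnd (psiVal a₂ a₃ a₄ a₅ 0 0 b₄ b₅) x,
      jEnd (psiVal a₂ a₃ a₄ a₅ 0 0 b₄ b₅) y] = omegaVal f₁ f₂ f₃ f₄ f₅ ![x, y] := by
  have hr := inv_sqrt_sq hst
  have h := omegaVal_sEnd f₁ f₂ f₃ f₄ f₅ a₂ a₃ a₄ a₅ b₄ b₅ hα hβ x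
    (sEnd (psiVal a₂ a₃ a₄ a₅ 0 0 b₄ b₅) y)
  rw [sEnd_sEnd_psiVal, ← quartic_psiVal] at h
  simp only [jEnd, LinearMap.smul_apply]
  generalize quartic (psiVal a₂ a₃ a₄ a₅ 0 0 b₄ b₅) = P at *
  generalize sEnd (psiVal a₂ a₃ a₄ a₅ 0 0 b₄ b₅) = S at *
  generalize (Real.sqrt (-P))⁻¹ = r at *
  simp only [omegaVal_apply, Pi.smul_apply, smul_eq_mul] at h ⊢
  have hm := congrArg (· * omegaVal f₁ f₂ f₃ f₄ f₅ ![x, y]) hr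
  simp only [omegaVal_apply] at hm
  linear_combination r ^ 2 * h - hm

theorem jPull_apply (θ : V6 [⋀^Fin 3]→ₗ[ℝ] ℝ) (x y z : V6) :
    jPull θ ![x, y, z] = θ ![jEnd θ x, jEnd θ y, jEnd θ z] := by
  have h := eq_vec_three fun i => jEnd θ (![x, y, z] i)
  simp only [Matrix.cons_val] at h
  rw [jPull, AlternatingMap.compLinearMap_apply, h]

/-- Hypothesis `hn` is g(ξ, ξ) = 1. It replaces the scaling factor (-P)^(-1/2) by a rational
expression in f₁, so that J*ψ can be differentiated without roots. -/
theorem jPull_psiVal (a₂ a₃ a₄ a₅ b₄ b₅ : ℝ) (h : a₄ * b₄ + a₅ * b₅ = 0) {f₁ : ℝ} (hf : f₁ ≠ 0)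
    (hst : IsStable (psiVal a₂ a₃ a₄ a₅ 0 0 b₄ b₅))
    (hn : f₁ * ((Real.sqrt (-quartic (psiVal a₂ a₃ a₄ a₅ 0 0 b₄ b₅)))⁻¹ *
      (2 * (a₂ * a₃ - a₄ ^ 2 - a₅ ^ 2))) = 1) :
    jPull (psiVal a₂ a₃ a₄ a₅ 0 0 b₄ b₅) =
      psiVal 0 0 (-(b₄ / f₁)) (-(b₅ / f₁)) (f₁ * a₂) (f₁ * a₃) (f₁ * a₄) (f₁ * a₅) := by
  have hr := inv_sqrt_sq hst
  have hP := quartic_psiVal a₂ a₃ a₄ a₅ b₄ b₅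
  rw [h] at hP
  ext v
  obtain ⟨x, y, z, rfl⟩ : ∃ x y z, v = ![x, y, z] :=
    ⟨v 0, v 1, v 2, eq_vec_three v⟩
  have ht := psiVal_sEnd_triple a₂ a₃ a₄ a₅ b₄ b₅ h x y z
  have hs := psiVal_sEnd a₂ a₃ a₄ a₅ b₄ b₅ h x y z
  rw [jPull_apply]
  simp only [jEnd, LinearMap.smul_apply]
  generalize quartic (psiVal a₂ a₃ a₄ a₅ 0 0 b₄ b₅) = P at *
  generalize sEnd (psiVal a₂ a₃ a₄ a₅ 0 0 b₄ b₅) = S at *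
  generalize (Real.sqrt (-P))⁻¹ = r at *
  have hN : r * (2 * (a₂ * a₃ - a₄ ^ 2 - a₅ ^ 2)) = 1 / f₁ := by
    field_simp
    linear_combination hn
  -- Since P = 4NB and r²P = -1, the factors 2rN and 2rB have product -1, and the first is 1/f₁.
  have hB : r * (2 * (b₄ ^ 2 + b₅ ^ 2)) = -f₁ := by
    rw [hP] at hr
    linear_combination f₁ * hr - r * (2 * (b₄ ^ 2 + b₅ ^ 2)) * hn
  have e : psiVal a₂ a₃ a₄ a₅ 0 0 b₄ b₅ ![r • S x, r • S y, r • S z] =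
      r ^ 3 * psiVal a₂ a₃ a₄ a₅ 0 0 b₄ b₅ ![S x, S y, S z] := by
    simp only [psiVal_apply, omegaVal_apply, Pi.smul_apply, smul_eq_mul]; ring
  have e' : psiVal 0 0 (-(b₄ / f₁)) (-(b₅ / f₁)) (f₁ * a₂) (f₁ * a₃) (f₁ * a₄) (f₁ * a₅)
      ![x, y, z] = -(1 / f₁) * psiVal 0 0 b₄ b₅ 0 0 0 0 ![x, y, z] +
      f₁ * psiVal 0 0 0 0 a₂ a₃ a₄ a₅ ![x, y, z] := by
    simp only [psiVal_apply, omegaVal_apply]; ring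
  rw [e, ht, hs, e', ← hN]
  generalize psiVal 0 0 b₄ b₅ 0 0 0 0 ![x, y, z] = X at *
  generalize psiVal 0 0 0 0 a₂ a₃ a₄ a₅ ![x, y, z] = Y at *
  linear_combination (r * (2 * (a₂ * a₃ - a₄ ^ 2 - a₅ ^ 2) * X + 2 * (b₄ ^ 2 + b₅ ^ 2) * Y)) * hr
    - Y * hB

theorem metric_xi (f₁ f₂ f₃ f₄ f₅ a₂ a₃ a₄ a₅ b₄ b₅ : ℝ) (w : V6) :
    metric (omegaVal f₁ f₂ f₃ f₄ f₅) (psiVal a₂ a₃ a₄ a₅ 0 0 b₄ b₅) (stdB 0) w =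
      f₁ * ((Real.sqrt (-quartic (psiVal a₂ a₃ a₄ a₅ 0 0 b₄ b₅)))⁻¹ *
        (2 * ((a₂ * a₃ - a₄ ^ 2 - a₅ ^ 2) * w 0 - (a₄ * b₄ + a₅ * b₅) * w 1))) := by
  rw [metric, jEnd, LinearMap.smul_apply, sEnd_psiVal]
  simp [omegaVal_apply, stdB]

/-! ### Exterior derivatives of invariant forms by left-invariant vector fields. -/

theorem eq_vec_one {X : Type*} (g : Fin 1 → X) : g = ![g 0] := by
  funext j
  fin_cases j
  rfl

theorem eq_vec_two {X : Type*} (g : Fin 2 → X) : g = ![g 0, g 1] := by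
  funext j
  fin_cases j <;> rfl

/-- The left-invariant vector field on the total space with value `w` at `(t, 1, 1)`. -/
def leftField (w u : Amb) : Amb := (w.1, u.2.1 * w.2.1, u.2.2 * w.2.2)

/-- The commutator bracket of `ℝ × ℍ × ℍ`. -/
def ambBracket (v w : Amb) : Amb :=
  (0, v.2.1 * w.2.1 - w.2.1 * v.2.1, v.2.2 * w.2.2 - w.2.2 * v.2.2)

/-- The left-invariant coframe at `(0, 1, 1)`. -/
def frameMap : Amb →ₗ[ℝ] V6 := coframe (0, 1, 1)

theorem coframe_leftField (w u : Amb) (h₁ : u.2.1 ≠ 0) (h₂ : u.2.2 ≠ 0) :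
    coframe u (leftField w u) = frameMap w := by
  simp only [coframe, frameMap, leftField, LinearMap.coe_mk, AddHom.coe_mk,
    inv_mul_cancel_left₀ h₁, inv_mul_cancel_left₀ h₂, inv_one, one_mul]

theorem leftField_surjective (u : Amb) (h₁ : u.2.1 ≠ 0) (h₂ : u.2.2 ≠ 0) (v : Amb) :
    ∃ w, v = leftField w u :=
  ⟨(v.1, u.2.1⁻¹ * v.2.1, u.2.2⁻¹ * v.2.2), by
    simp only [leftField, mul_inv_cancel_left₀ h₁, mul_inv_cancel_left₀ h₂]⟩

theorem hasFDerivAt_leftField (w u : Amb) : ∃ L : Amb →L[ℝ] Amb,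
    HasFDerivAt (leftField w) L u ∧ ∀ x, L x = (0, x.2.1 * w.2.1, x.2.2 * w.2.2) := by
  have h₁ : HasFDerivAt (fun u : Amb => u.2.1)
      ((ContinuousLinearMap.fst ℝ ℍ[ℝ] ℍ[ℝ]) ∘L (ContinuousLinearMap.snd ℝ ℝ (ℍ[ℝ] × ℍ[ℝ]))) u :=
    ((ContinuousLinearMap.fst ℝ ℍ[ℝ] ℍ[ℝ]) ∘L
      (ContinuousLinearMap.snd ℝ ℝ (ℍ[ℝ] × ℍ[ℝ]))).hasFDerivAt
  have h₂ : HasFDerivAt (fun u : Amb => u.2.2)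
      ((ContinuousLinearMap.snd ℝ ℍ[ℝ] ℍ[ℝ]) ∘L (ContinuousLinearMap.snd ℝ ℝ (ℍ[ℝ] × ℍ[ℝ]))) u :=
    ((ContinuousLinearMap.snd ℝ ℍ[ℝ] ℍ[ℝ]) ∘L
      (ContinuousLinearMap.snd ℝ ℝ (ℍ[ℝ] × ℍ[ℝ]))).hasFDerivAt
  exact ⟨_, (hasFDerivAt_const w.1 u).prodMk ((h₁.mul_const' w.2.1).prodMk (h₂.mul_const' w.2.2)),
    fun x => by simp⟩

theorem lieBracket_leftField (v w u : Amb) :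
    VectorField.lieBracket ℝ (leftField v) (leftField w) u = leftField (ambBracket v w) u := by
  obtain ⟨L, hL, hL'⟩ := hasFDerivAt_leftField v u
  obtain ⟨L₂, hL₂, hL₂'⟩ := hasFDerivAt_leftField w u
  rw [VectorField.lieBracket, hL.fderiv, hL₂.fderiv, hL', hL₂']
  simp [leftField, ambBracket, mul_sub, mul_assoc]

theorem differentiableAt_coframe (u : Amb) (h₁ : u.2.1 ≠ 0) (h₂ : u.2.2 ≠ 0) :
    DifferentiableAt ℝ (fun u => LinearMap.toContinuousLinearMap (coframe u)) u := by
  let A : Amb →L[ℝ] ℝ := ContinuousLinearMap.fst ℝ ℝ (ℍ[ℝ] × ℍ[ℝ])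
  let B : Amb →L[ℝ] ℍ[ℝ] :=
    (ContinuousLinearMap.fst ℝ ℍ[ℝ] ℍ[ℝ]) ∘L (ContinuousLinearMap.snd ℝ ℝ (ℍ[ℝ] × ℍ[ℝ]))
  let C : Amb →L[ℝ] ℍ[ℝ] :=
    (ContinuousLinearMap.snd ℝ ℍ[ℝ] ℍ[ℝ]) ∘L (ContinuousLinearMap.snd ℝ ℝ (ℍ[ℝ] × ℍ[ℝ]))
  let A' : ℝ →L[ℝ] Amb := ContinuousLinearMap.inl ℝ ℝ (ℍ[ℝ] × ℍ[ℝ])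
  let B' : ℍ[ℝ] →L[ℝ] Amb :=
    (ContinuousLinearMap.inr ℝ ℝ (ℍ[ℝ] × ℍ[ℝ])) ∘L (ContinuousLinearMap.inl ℝ ℍ[ℝ] ℍ[ℝ])
  let C' : ℍ[ℝ] →L[ℝ] Amb :=
    (ContinuousLinearMap.inr ℝ ℝ (ℍ[ℝ] × ℍ[ℝ])) ∘L (ContinuousLinearMap.inr ℝ ℍ[ℝ] ℍ[ℝ])
  -- The coframe is the fixed map `frameMap` after left multiplication by the inverse quaternions,
  -- so differentiability reduces to that of inversion.
  have e : (fun u => LinearMap.toContinuousLinearMap (coframe u)) = fun u : Amb =>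
      LinearMap.toContinuousLinearMap frameMap ∘L (A' ∘L A +
        B' ∘L (ContinuousLinearMap.mul ℝ ℍ[ℝ] (B u)⁻¹) ∘L B +
        C' ∘L (ContinuousLinearMap.mul ℝ ℍ[ℝ] (C u)⁻¹) ∘L C) := by
    refine funext fun u => ContinuousLinearMap.ext fun w => funext fun i => ?_
    fin_cases i <;> simp [frameMap, coframe, A, B, C, A', B', C']
    ring
  rw [e]
  have hB : DifferentiableAt ℝ (fun u : Amb => (B u)⁻¹) u :=
    (hasFDerivAt_inv' (𝕜 := ℝ) (show B u ≠ 0 from h₁)).differentiableAt.comp u B.differentiableAt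
  have hC : DifferentiableAt ℝ (fun u : Amb => (C u)⁻¹) u :=
    (hasFDerivAt_inv' (𝕜 := ℝ) (show C u ≠ 0 from h₂)).differentiableAt.comp u C.differentiableAt
  fun_prop

theorem differentiableAt_invForm {k : ℕ} {β : ℝ → V6 [⋀^Fin k]→ₗ[ℝ] ℝ} (u : Amb)
    (h₁ : u.2.1 ≠ 0) (h₂ : u.2.2 ≠ 0) (hβ : DifferentiableAt ℝ (fun t => toCont (β t)) u.1) :
    DifferentiableAt ℝ (invForm β) u :=
  DifferentiableAt.continuousAlternatingMapCompContinuousLinearMap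
    (f := fun u : Amb => toCont (β u.1)) (hβ.comp u differentiableAt_fst)
    (differentiableAt_coframe u h₁ h₂)

/-- The coframe is constant on left-invariant fields, so the values of an invariant form on them
depend on t alone. -/
theorem invForm_leftField {k : ℕ} (β : ℝ → V6 [⋀^Fin k]→ₗ[ℝ] ℝ) (u : Amb)
    (h₁ : u.2.1 ≠ 0) (h₂ : u.2.2 ≠ 0) (w : Fin k → Amb) :
    invForm β u (fun i => leftField (w i) u) = β u.1 fun i => frameMap (w i) := by
  simp only [← coframe_leftField _ u h₁ h₂]
  rfl

theorem fderiv_invForm_leftField {k : ℕ} {β : ℝ → V6 [⋀^Fin k]→ₗ[ℝ] ℝ}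
    {β' : V6 [⋀^Fin k]→ₗ[ℝ] ℝ} (u : Amb)
    (h₁ : u.2.1 ≠ 0) (h₂ : u.2.2 ≠ 0) (hβ : HasDerivAt (fun t => toCont (β t)) (toCont β') u.1)
    (w : Fin k → Amb) (x : Amb) :
    fderiv ℝ (fun u => invForm β u fun i => leftField (w i) u) u x =
      x.1 * β' fun i => frameMap (w i) := by
  have hev : (fun u => invForm β u fun i => leftField (w i) u) =ᶠ[nhds u]
      fun u : Amb => toCont (β u.1) fun i => frameMap (w i) := by
    have o₁ : ∀ᶠ u : Amb in nhds u, u.2.1 ≠ 0 :=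
      ContinuousAt.eventually_ne (by fun_prop) h₁
    have o₂ : ∀ᶠ u : Amb in nhds u, u.2.2 ≠ 0 :=
      ContinuousAt.eventually_ne (by fun_prop) h₂
    filter_upwards [o₁, o₂] with u h₁ h₂
    exact invForm_leftField β u h₁ h₂ w
  rw [hev.fderiv_eq]
  have hd : HasFDerivAt (fun u : Amb => toCont (β u.1)) _ u :=
    (hβ.hasFDerivAt).comp u (hasFDerivAt_fst (p := u))
  rw [(hd.continuousAlternatingMap_apply_const fun i => frameMap (w i)).fderiv]
  simp
  left
  rfl

/-- The invariant formula for d on left-invariant fields: the derivative terms see only d/dt, and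
the bracket terms are commutators in ℝ × ℍ × ℍ. Computing d becomes finite algebra. -/
theorem extDeriv_invForm {k : ℕ} {β : ℝ → V6 [⋀^Fin (k + 1)]→ₗ[ℝ] ℝ}
    {β' : V6 [⋀^Fin (k + 1)]→ₗ[ℝ] ℝ} (u : Amb)
    (h₁ : u.2.1 ≠ 0) (h₂ : u.2.2 ≠ 0) (hβ : HasDerivAt (fun t => toCont (β t)) (toCont β') u.1)
    (w : Fin (k + 2) → Amb) :
    extDeriv (invForm β) u (fun i => leftField (w i) u) =
      (∑ i, (-1 : ℤ) ^ i.val • ((w i).1 * β' fun j => frameMap (i.removeNth w j))) -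
        ∑ i : Fin (k + 1), ∑ j ≥ i, (-1 : ℤ) ^ (i + j : ℕ) •
          β u.1 (Matrix.vecCons (frameMap (ambBracket (w i.castSucc) (w j.succ)))
            fun l => frameMap (j.removeNth (i.castSucc.removeNth w) l)) := by
  rw [extDeriv_apply_vectorField (V := fun i => leftField (w i))
    (differentiableAt_invForm u h₁ h₂ hβ.differentiableAt)
    (fun i => (hasFDerivAt_leftField (w i) u).choose_spec.1.differentiableAt)]
  congr 1
  · refine Finset.sum_congr rfl fun i _ => ?_
    congr 1
    exact fderiv_invForm_leftField u h₁ h₂ hβ (i.removeNth w) _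
  · refine Finset.sum_congr rfl fun i _ => Finset.sum_congr rfl fun j _ => ?_
    rw [lieBracket_leftField]
    congr 1
    have e := invForm_leftField β u h₁ h₂
      (Matrix.vecCons (ambBracket (w i.castSucc) (w j.succ)) (j.removeNth (i.castSucc.removeNth w)))
    convert e using 2
    · funext l
      refine Fin.cases rfl (fun l => rfl) l
    · funext l
      refine Fin.cases rfl (fun l => rfl) l

theorem extDeriv_invForm_two {β : ℝ → V6 [⋀^Fin 2]→ₗ[ℝ] ℝ} {β' : V6 [⋀^Fin 2]→ₗ[ℝ] ℝ} (u : Amb)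
    (h₁ : u.2.1 ≠ 0) (h₂ : u.2.2 ≠ 0) (hβ : HasDerivAt (fun t => toCont (β t)) (toCont β') u.1)
    (x y z : Amb) :
    extDeriv (invForm β) u ![leftField x u, leftField y u, leftField z u] =
      x.1 * β' ![frameMap y, frameMap z] - y.1 * β' ![frameMap x, frameMap z] +
        z.1 * β' ![frameMap x, frameMap y] - β u.1 ![frameMap (ambBracket x y), frameMap z] +
        β u.1 ![frameMap (ambBracket x z), frameMap y] -
        β u.1 ![frameMap (ambBracket y z), frameMap x] := by
  have e := extDeriv_invForm u h₁ h₂ hβ ![x, y, z]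
  simp only [eq_vec_three (fun i : Fin 3 => leftField (_ : Amb) u), Matrix.cons_val] at e
  have i₀ : Finset.Ici (0 : Fin 2) = {0, 1} := by decide
  have i₁ : Finset.Ici (1 : Fin 2) = {1} := by decide
  rw [Fin.sum_univ_three, Fin.sum_univ_two, i₀, i₁, Finset.sum_pair (by decide),
    Finset.sum_singleton] at e
  simp [eq_vec_two (fun l : Fin 2 => frameMap (_ : Amb)),
    eq_vec_one (fun l : Fin 1 => frameMap (_ : Amb)), Fin.removeNth, Fin.succAbove] at e
  rw [e]
  ring

theorem extDeriv_invForm_three {β : ℝ → V6 [⋀^Fin 3]→ₗ[ℝ] ℝ} {β' : V6 [⋀^Fin 3]→ₗ[ℝ] ℝ} (u : Amb)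
    (h₁ : u.2.1 ≠ 0) (h₂ : u.2.2 ≠ 0) (hβ : HasDerivAt (fun t => toCont (β t)) (toCont β') u.1)
    (x y z w : Amb) :
    extDeriv (invForm β) u ![leftField x u, leftField y u, leftField z u, leftField w u] =
      x.1 * β' ![frameMap y, frameMap z, frameMap w] -
        y.1 * β' ![frameMap x, frameMap z, frameMap w] +
        z.1 * β' ![frameMap x, frameMap y, frameMap w] -
        w.1 * β' ![frameMap x, frameMap y, frameMap z] -
        β u.1 ![frameMap (ambBracket x y), frameMap z, frameMap w] +
        β u.1 ![frameMap (ambBracket x z), frameMap y, frameMap w] -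
        β u.1 ![frameMap (ambBracket x w), frameMap y, frameMap z] -
        β u.1 ![frameMap (ambBracket y z), frameMap x, frameMap w] +
        β u.1 ![frameMap (ambBracket y w), frameMap x, frameMap z] -
        β u.1 ![frameMap (ambBracket z w), frameMap x, frameMap y] := by
  have e := extDeriv_invForm u h₁ h₂ hβ ![x, y, z, w]
  simp only [eq_vec_four (fun i : Fin 4 => leftField (_ : Amb) u), Matrix.cons_val] at e
  have i₀ : Finset.Ici (0 : Fin 3) = {0, 1, 2} := by decide
  have i₁ : Finset.Ici (1 : Fin 3) = {1, 2} := by decide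
  have i₂ : Finset.Ici (2 : Fin 3) = {2} := by decide
  rw [Fin.sum_univ_four, Fin.sum_univ_three, i₀, i₁, i₂, Finset.sum_pair (by decide),
    Finset.sum_singleton, Finset.sum_insert (by decide), Finset.sum_pair (by decide)] at e
  simp [eq_vec_three (fun l : Fin 3 => frameMap (_ : Amb)),
    eq_vec_two (fun l : Fin 2 => frameMap (_ : Amb)), Fin.removeNth, Fin.succAbove] at e
  rw [e]
  ring

/-! ### Structure equations and the derivatives of ω and ψ. -/

theorem frameMap_apply (w : Amb) : frameMap w = ![w.1, w.2.1.imI - w.2.2.imI,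
    2 * Real.sqrt 2 * w.2.1.imJ, 2 * Real.sqrt 2 * w.2.1.imK,
    2 * Real.sqrt 2 * w.2.2.imJ, 2 * Real.sqrt 2 * w.2.2.imK] := by
  simp [frameMap, coframe]

theorem frameMap_zero (w : Amb) : frameMap w 0 = w.1 := by
  simp [frameMap_apply]

theorem frameMap_surjective : Function.Surjective frameMap := fun v => by
  have hs : Real.sqrt 2 ≠ 0 := by positivity
  refine ⟨(v 0, ⟨0, v 1, v 2 / (2 * Real.sqrt 2), v 3 / (2 * Real.sqrt 2)⟩,
    ⟨0, 0, v 4 / (2 * Real.sqrt 2), v 5 / (2 * Real.sqrt 2)⟩), ?_⟩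
  rw [frameMap_apply]
  ext i
  fin_cases i <;> simp <;> field_simp

/-- The component along the isotropy generator `U`. -/
def isoComp (w : Amb) : ℝ := w.2.1.imI + w.2.2.imI

/-- The structure equations of `su₂ + su₂` with respect to `U, A, E₁, V₁, E₂, V₂`. -/
theorem frameMap_ambBracket (x y : Amb) : frameMap (ambBracket x y) = ![0,
    (frameMap x 2 * frameMap y 3 - frameMap x 3 * frameMap y 2 - frameMap x 4 * frameMap y 5 +
      frameMap x 5 * frameMap y 4) / 4,
    frameMap x 3 * (isoComp y + frameMap y 1) - (isoComp x + frameMap x 1) * frameMap y 3,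
    (isoComp x + frameMap x 1) * frameMap y 2 - frameMap x 2 * (isoComp y + frameMap y 1),
    frameMap x 5 * (isoComp y - frameMap y 1) - (isoComp x - frameMap x 1) * frameMap y 5,
    (isoComp x - frameMap x 1) * frameMap y 4 - frameMap x 4 * (isoComp y - frameMap y 1)] := by
  have h : Real.sqrt 2 * Real.sqrt 2 = 2 := Real.mul_self_sqrt (by norm_num)
  simp only [frameMap_apply, ambBracket, isoComp]
  ext i
  fin_cases i <;> simp
  -- This is the A-component, the only one quadratic in the E- and V-coordinates, so the
  -- normalization of E and V enters through √2·√2 = 2.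
  · linear_combination (x.2.1.imJ * y.2.1.imK - x.2.1.imK * y.2.1.imJ - x.2.2.imJ * y.2.2.imK +
      x.2.2.imK * y.2.2.imJ) * (-h)
  all_goals ring

theorem toCont_add {k : ℕ} (α β : V6 [⋀^Fin k]→ₗ[ℝ] ℝ) : toCont (α + β) = toCont α + toCont β :=
  rfl

theorem toCont_smul {k : ℕ} (c : ℝ) (α : V6 [⋀^Fin k]→ₗ[ℝ] ℝ) : toCont (c • α) = c • toCont α :=
  rfl

theorem hasDerivAt_omegaForm {f₁ f₂ f₃ f₄ f₅ : ℝ → ℝ} {c₁ c₂ c₃ c₄ c₅ t : ℝ}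
    (h₁ : HasDerivAt f₁ c₁ t) (h₂ : HasDerivAt f₂ c₂ t) (h₃ : HasDerivAt f₃ c₃ t)
    (h₄ : HasDerivAt f₄ c₄ t) (h₅ : HasDerivAt f₅ c₅ t) :
    HasDerivAt (fun t => toCont (omegaForm f₁ f₂ f₃ f₄ f₅ t)) (toCont (omegaVal c₁ c₂ c₃ c₄ c₅))
      t := by
  simp only [omegaForm, omegaVal, toCont_add, toCont_smul]
  exact ((((h₁.smul_const _).add (h₂.smul_const _)).add (h₃.smul_const _)).add
    (h₄.smul_const _)).add (h₅.smul_const (toCont om5))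

theorem hasDerivAt_psiForm {a₂ a₃ a₄ a₅ b₂ b₃ b₄ b₅ : ℝ → ℝ} {a₂' a₃' a₄' a₅' b₂' b₃' b₄' b₅' t : ℝ}
    (h₁ : HasDerivAt a₂ a₂' t) (h₂ : HasDerivAt a₃ a₃' t) (h₃ : HasDerivAt a₄ a₄' t)
    (h₄ : HasDerivAt a₅ a₅' t) (h₅ : HasDerivAt b₂ b₂' t) (h₆ : HasDerivAt b₃ b₃' t)
    (h₇ : HasDerivAt b₄ b₄' t) (h₈ : HasDerivAt b₅ b₅' t) :
    HasDerivAt (fun t => toCont (psiForm a₂ a₃ a₄ a₅ b₂ b₃ b₄ b₅ t))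
      (toCont (psiVal a₂' a₃' a₄' a₅' b₂' b₃' b₄' b₅')) t := by
  simp only [psiForm, psiVal, toCont_add, toCont_smul]
  exact (((((((h₁.smul_const _).add (h₂.smul_const _)).add (h₃.smul_const _)).add
    (h₄.smul_const _)).add (h₅.smul_const _)).add (h₆.smul_const _)).add (h₇.smul_const _)).add
    (h₈.smul_const (toCont (psi2 om5)))

/-- The structure equations amount to d(ξ*∧A*) = ¼ ξ*∧(ω² - ω³), dω² = dω³ = 0, dω⁴ = -2 A*∧ω⁵ and
dω⁵ = 2 A*∧ω⁴. The isotropy components cancel because the ωⁱ are K-invariant. -/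
theorem extDeriv_omegaForm {f₁ f₂ f₃ f₄ f₅ : ℝ → ℝ} {c₁ c₂ c₃ c₄ c₅ : ℝ} (u : Amb)
    (hu₁ : u.2.1 ≠ 0) (hu₂ : u.2.2 ≠ 0)
    (h₁ : HasDerivAt f₁ c₁ u.1) (h₂ : HasDerivAt f₂ c₂ u.1) (h₃ : HasDerivAt f₃ c₃ u.1)
    (h₄ : HasDerivAt f₄ c₄ u.1) (h₅ : HasDerivAt f₅ c₅ u.1) (x y z : Amb) :
    extDeriv (invForm (omegaForm f₁ f₂ f₃ f₄ f₅)) u ![leftField x u, leftField y u, leftField z u] =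
      psiVal (c₂ + f₁ u.1 / 4) (c₃ - f₁ u.1 / 4) c₄ c₅ 0 0 (2 * f₅ u.1) (-2 * f₄ u.1)
        ![frameMap x, frameMap y, frameMap z] := by
  rw [extDeriv_invForm_two u hu₁ hu₂ (hasDerivAt_omegaForm h₁ h₂ h₃ h₄ h₅)]
  rw [show omegaForm f₁ f₂ f₃ f₄ f₅ u.1 = omegaVal (f₁ u.1) (f₂ u.1) (f₃ u.1) (f₄ u.1) (f₅ u.1)
    from rfl]
  simp only [frameMap_ambBracket, ← frameMap_zero]
  simp only [psiVal_apply, omegaVal_apply, Matrix.cons_val]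
  generalize frameMap x = X, frameMap y = Y, frameMap z = Z
  ring

/-- The `4`-form `ξ^* ∧ A^* ∧ (∑ cᵢ ωⁱ) + e ω² ∧ ω³`. -/
def fourVal (c₂ c₃ c₄ c₅ e : ℝ) : V6 [⋀^Fin 4]→ₗ[ℝ] ℝ :=
  wedge om1 (omegaVal 0 c₂ c₃ c₄ c₅) + e • wedge om2 om3

theorem fourVal_apply (c₂ c₃ c₄ c₅ e : ℝ) (x y z w : V6) : fourVal c₂ c₃ c₄ c₅ e ![x, y, z, w] =
    wedge om1 (omegaVal 0 c₂ c₃ c₄ c₅) ![x, y, z, w] + e * wedge om2 om3 ![x, y, z, w] :=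
  rfl

/-- The ξ-part contributes only through dω⁴ and dω⁵. The term in ω²∧ω³ comes from dA* wedged with ω²
and ω³. -/
theorem extDeriv_psiForm {a₂ a₃ a₄ a₅ b₂ b₃ b₄ b₅ : ℝ → ℝ}
    {a₂' a₃' a₄' a₅' b₂' b₃' b₄' b₅' : ℝ} (u : Amb) (hu₁ : u.2.1 ≠ 0) (hu₂ : u.2.2 ≠ 0)
    (h₁ : HasDerivAt a₂ a₂' u.1) (h₂ : HasDerivAt a₃ a₃' u.1) (h₃ : HasDerivAt a₄ a₄' u.1)
    (h₄ : HasDerivAt a₅ a₅' u.1) (h₅ : HasDerivAt b₂ b₂' u.1) (h₆ : HasDerivAt b₃ b₃' u.1)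
    (h₇ : HasDerivAt b₄ b₄' u.1) (h₈ : HasDerivAt b₅ b₅' u.1) (x y z w : Amb) :
    extDeriv (invForm (psiForm a₂ a₃ a₄ a₅ b₂ b₃ b₄ b₅)) u
      ![leftField x u, leftField y u, leftField z u, leftField w u] =
      fourVal b₂' b₃' (b₄' - 2 * a₅ u.1) (b₅' + 2 * a₄ u.1) ((b₂ u.1 - b₃ u.1) / 4)
        ![frameMap x, frameMap y, frameMap z, frameMap w] := by
  rw [extDeriv_invForm_three u hu₁ hu₂ (hasDerivAt_psiForm h₁ h₂ h₃ h₄ h₅ h₆ h₇ h₈)]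
  rw [show psiForm a₂ a₃ a₄ a₅ b₂ b₃ b₄ b₅ u.1 = psiVal (a₂ u.1) (a₃ u.1) (a₄ u.1) (a₅ u.1)
    (b₂ u.1) (b₃ u.1) (b₄ u.1) (b₅ u.1) from rfl]
  rw [fourVal_apply, wedge_two_two, wedge_two_two]
  simp only [om1_apply, om2_apply, om3_apply]
  simp only [frameMap_ambBracket, ← frameMap_zero]
  simp only [psiVal_apply, omegaVal_apply, Matrix.cons_val]
  generalize frameMap x = X, frameMap y = Y, frameMap z = Z, frameMap w = W
  ring

theorem stdB_apply (i j : Fin 6) : stdB i j = if j = i then 1 else 0 := by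
  simp [stdB, Pi.single_apply]

theorem psiVal_inj {a₂ a₃ a₄ a₅ b₂ b₃ b₄ b₅ a₂' a₃' a₄' a₅' b₂' b₃' b₄' b₅' : ℝ}
    (h : psiVal a₂ a₃ a₄ a₅ b₂ b₃ b₄ b₅ = psiVal a₂' a₃' a₄' a₅' b₂' b₃' b₄' b₅') :
    (a₂ = a₂' ∧ a₃ = a₃' ∧ a₄ = a₄' ∧ a₅ = a₅') ∧ b₂ = b₂' ∧ b₃ = b₃' ∧ b₄ = b₄' ∧ b₅ = b₅' := by
  have e : ∀ i j k : Fin 6, psiVal a₂ a₃ a₄ a₅ b₂ b₃ b₄ b₅ ![stdB i, stdB j, stdB k] =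
    psiVal a₂' a₃' a₄' a₅' b₂' b₃' b₄' b₅' ![stdB i, stdB j, stdB k] := fun i j k => by rw [h]
  simp only [psiVal_apply, omegaVal_apply, stdB_apply] at e
  refine ⟨⟨?_, ?_, ?_, ?_⟩, ?_, ?_, ?_, ?_⟩
  · simpa using e 0 2 3
  · simpa using e 0 4 5
  · simpa using e 0 2 4
  · simpa using e 0 2 5
  · simpa using e 1 2 3
  · simpa using e 1 4 5
  · simpa using e 1 2 4
  · simpa using e 1 2 5

theorem fourVal_inj {c₂ c₃ c₄ c₅ e c₂' c₃' c₄' c₅' e' : ℝ}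
    (h : fourVal c₂ c₃ c₄ c₅ e = fourVal c₂' c₃' c₄' c₅' e') :
    c₂ = c₂' ∧ c₃ = c₃' ∧ c₄ = c₄' ∧ c₅ = c₅' ∧ e = e' := by
  have q : ∀ i j k l : Fin 6, fourVal c₂ c₃ c₄ c₅ e ![stdB i, stdB j, stdB k, stdB l] =
    fourVal c₂' c₃' c₄' c₅' e' ![stdB i, stdB j, stdB k, stdB l] := fun i j k l => by rw [h]
  simp only [fourVal_apply, wedge_two_two, om1_apply, om2_apply, om3_apply, omegaVal_apply,
    stdB_apply] at q
  refine ⟨?_, ?_, ?_, ?_, ?_⟩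
  · simpa using q 0 1 2 3
  · simpa using q 0 1 4 5
  · simpa using q 0 1 2 4
  · simpa using q 0 1 2 5
  · simpa using q 2 3 4 5

theorem smul_psiVal (c a₂ a₃ a₄ a₅ b₂ b₃ b₄ b₅ : ℝ) : c • psiVal a₂ a₃ a₄ a₅ b₂ b₃ b₄ b₅ =
    psiVal (c * a₂) (c * a₃) (c * a₄) (c * a₅) (c * b₂) (c * b₃) (c * b₄) (c * b₅) := by
  simp only [psiVal, smul_add, smul_smul]

theorem smul_wedge_omegaVal (c f₁ f₂ f₃ f₄ f₅ : ℝ) :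
    c • wedge (omegaVal f₁ f₂ f₃ f₄ f₅) (omegaVal f₁ f₂ f₃ f₄ f₅) =
      fourVal (c * (2 * f₁ * f₂)) (c * (2 * f₁ * f₃)) (c * (2 * f₁ * f₄)) (c * (2 * f₁ * f₅))
        (c * (2 * (f₂ * f₃ - f₄ ^ 2 - f₅ ^ 2))) := by
  refine AlternatingMap.ext fun v => ?_
  rw [eq_vec_four v, fourVal_apply, AlternatingMap.smul_apply, smul_eq_mul, wedge_two_two,
    wedge_two_two, wedge_two_two]
  simp only [om1_apply, om2_apply, om3_apply, omegaVal_apply]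
  ring

/-- Left-invariant fields attain every tangent vector at u, and `frameMap` is onto the model, so
identities of forms upstairs and on the model are equivalent. -/
theorem eq_smul_invForm_iff {k : ℕ} (γ : ℝ → V6 [⋀^Fin k]→ₗ[ℝ] ℝ) (δ : V6 [⋀^Fin k]→ₗ[ℝ] ℝ)
    (η : Amb [⋀^Fin k]→L[ℝ] ℝ) (c : ℝ) (u : Amb) (h₁ : u.2.1 ≠ 0) (h₂ : u.2.2 ≠ 0)
    (h : ∀ w : Fin k → Amb, η (fun i => leftField (w i) u) = δ fun i => frameMap (w i)) :
    η = c • invForm γ u ↔ δ = c • γ u.1 := by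
  constructor
  · intro e
    refine AlternatingMap.ext fun v => ?_
    choose w hw using fun i => frameMap_surjective (v i)
    have e' := h w
    rw [e, ContinuousAlternatingMap.smul_apply, invForm_leftField γ u h₁ h₂] at e'
    simpa only [hw, AlternatingMap.smul_apply] using e'.symm
  · intro e
    refine ContinuousAlternatingMap.ext fun v => ?_
    choose w hw using fun i => leftField_surjective u h₁ h₂ (v i)
    rw [show v = fun i => leftField (w i) u from funext hw, h, e,
      ContinuousAlternatingMap.smul_apply, invForm_leftField γ u h₁ h₂, AlternatingMap.smul_apply]

theorem extDeriv_omegaForm_eq_iff {f₁ f₂ f₃ f₄ f₅ : ℝ → ℝ} {c₁ c₂ c₃ c₄ c₅ : ℝ} (u : Amb)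
    (hu₁ : u.2.1 ≠ 0) (hu₂ : u.2.2 ≠ 0)
    (h₁ : HasDerivAt f₁ c₁ u.1) (h₂ : HasDerivAt f₂ c₂ u.1) (h₃ : HasDerivAt f₃ c₃ u.1)
    (h₄ : HasDerivAt f₄ c₄ u.1) (h₅ : HasDerivAt f₅ c₅ u.1)
    (γ : ℝ → V6 [⋀^Fin 3]→ₗ[ℝ] ℝ) (c : ℝ) :
    extDeriv (invForm (omegaForm f₁ f₂ f₃ f₄ f₅)) u = c • invForm γ u ↔
      psiVal (c₂ + f₁ u.1 / 4) (c₃ - f₁ u.1 / 4) c₄ c₅ 0 0 (2 * f₅ u.1) (-2 * f₄ u.1) =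
        c • γ u.1 := by
  refine eq_smul_invForm_iff γ _ _ c u hu₁ hu₂ fun w => ?_
  rw [eq_vec_three fun i => leftField (w i) u, eq_vec_three fun i => frameMap (w i)]
  exact extDeriv_omegaForm u hu₁ hu₂ h₁ h₂ h₃ h₄ h₅ _ _ _

theorem extDeriv_psiForm_eq_iff {a₂ a₃ a₄ a₅ b₂ b₃ b₄ b₅ : ℝ → ℝ}
    {a₂' a₃' a₄' a₅' b₂' b₃' b₄' b₅' : ℝ} (u : Amb) (hu₁ : u.2.1 ≠ 0) (hu₂ : u.2.2 ≠ 0)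
    (h₁ : HasDerivAt a₂ a₂' u.1) (h₂ : HasDerivAt a₃ a₃' u.1) (h₃ : HasDerivAt a₄ a₄' u.1)
    (h₄ : HasDerivAt a₅ a₅' u.1) (h₅ : HasDerivAt b₂ b₂' u.1) (h₆ : HasDerivAt b₃ b₃' u.1)
    (h₇ : HasDerivAt b₄ b₄' u.1) (h₈ : HasDerivAt b₅ b₅' u.1)
    (γ : ℝ → V6 [⋀^Fin 4]→ₗ[ℝ] ℝ) (c : ℝ) :
    extDeriv (invForm (psiForm a₂ a₃ a₄ a₅ b₂ b₃ b₄ b₅)) u = c • invForm γ u ↔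
      fourVal b₂' b₃' (b₄' - 2 * a₅ u.1) (b₅' + 2 * a₄ u.1) ((b₂ u.1 - b₃ u.1) / 4) =
        c • γ u.1 := by
  refine eq_smul_invForm_iff γ _ _ c u hu₁ hu₂ fun w => ?_
  rw [eq_vec_four fun i => leftField (w i) u, eq_vec_four fun i => frameMap (w i)]
  exact extDeriv_psiForm u hu₁ hu₂ h₁ h₂ h₃ h₄ h₅ h₆ h₇ h₈ _ _ _ _

/-- The `3`-form `J^* ψ`, when its normalization is fixed by `f₁`, satisfies
`d (J^* ψ) = c ω ∧ ω` if and only if its coefficients satisfy a differential system. -/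
theorem extDeriv_jPull_eq_iff {f₁ f₂ f₃ f₄ f₅ a₂ a₃ a₄ a₅ b₄ b₅ : ℝ → ℝ}
    {ps : ℝ → V6 [⋀^Fin 3]→ₗ[ℝ] ℝ} (u : Amb) (hu₁ : u.2.1 ≠ 0) (hu₂ : u.2.2 ≠ 0)
    (hps : (fun t => jPull (ps t)) =ᶠ[nhds u.1]
      psiForm 0 0 (fun t => -(b₄ t / f₁ t)) (fun t => -(b₅ t / f₁ t)) (fun t => f₁ t * a₂ t)
        (fun t => f₁ t * a₃ t) (fun t => f₁ t * a₄ t) (fun t => f₁ t * a₅ t))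
    (hf : f₁ u.1 ≠ 0) (h₁ : DifferentiableAt ℝ f₁ u.1) (h₂ : DifferentiableAt ℝ a₂ u.1)
    (h₃ : DifferentiableAt ℝ a₃ u.1) (h₄ : DifferentiableAt ℝ a₄ u.1)
    (h₅ : DifferentiableAt ℝ a₅ u.1) (h₆ : DifferentiableAt ℝ b₄ u.1)
    (h₇ : DifferentiableAt ℝ b₅ u.1) (c : ℝ) :
    extDeriv (invForm fun t => jPull (ps t)) u = c • invForm
      (fun t => wedge (omegaForm f₁ f₂ f₃ f₄ f₅ t) (omegaForm f₁ f₂ f₃ f₄ f₅ t)) u ↔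
    deriv (fun t => f₁ t * a₂ t) u.1 = c * (2 * f₁ u.1 * f₂ u.1) ∧
    deriv (fun t => f₁ t * a₃ t) u.1 = c * (2 * f₁ u.1 * f₃ u.1) ∧
    deriv (fun t => f₁ t * a₄ t) u.1 + 2 * (b₅ u.1 / f₁ u.1) = c * (2 * f₁ u.1 * f₄ u.1) ∧
    deriv (fun t => f₁ t * a₅ t) u.1 - 2 * (b₄ u.1 / f₁ u.1) = c * (2 * f₁ u.1 * f₅ u.1) ∧
    (f₁ u.1 * a₂ u.1 - f₁ u.1 * a₃ u.1) / 4 =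
      c * (2 * (f₂ u.1 * f₃ u.1 - f₄ u.1 ^ 2 - f₅ u.1 ^ 2)) := by
  have hev : invForm (fun t => jPull (ps t)) =ᶠ[nhds u] invForm (psiForm 0 0
      (fun t => -(b₄ t / f₁ t)) (fun t => -(b₅ t / f₁ t)) (fun t => f₁ t * a₂ t)
        (fun t => f₁ t * a₃ t) (fun t => f₁ t * a₄ t) (fun t => f₁ t * a₅ t)) := by
    filter_upwards [(continuousAt_fst (p := u)).eventually hps] with v hv
    simp only [invForm]
    rw [hv]
  have d₄ : HasDerivAt (fun t => -(b₄ t / f₁ t)) _ u.1 := (h₆.fun_div h₁ hf).fun_neg.hasDerivAt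
  have d₅ : HasDerivAt (fun t => -(b₅ t / f₁ t)) _ u.1 := (h₇.fun_div h₁ hf).fun_neg.hasDerivAt
  rw [hev.extDeriv_eq, extDeriv_psiForm_eq_iff u hu₁ hu₂ (hasDerivAt_zero _)
    (hasDerivAt_zero _) d₄ d₅ (h₁.fun_mul h₂).hasDerivAt (h₁.fun_mul h₃).hasDerivAt
    (h₁.fun_mul h₄).hasDerivAt (h₁.fun_mul h₅).hasDerivAt]
  rw [show omegaForm f₁ f₂ f₃ f₄ f₅ u.1 = omegaVal (f₁ u.1) (f₂ u.1) (f₃ u.1) (f₄ u.1) (f₅ u.1)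
    from rfl, smul_wedge_omegaVal]
  constructor
  · intro h
    obtain ⟨e₁, e₂, e₃, e₄, e₅⟩ := fourVal_inj h
    refine ⟨e₁, e₂, ?_, ?_, e₅⟩
    · rw [← e₃]; ring
    · rw [← e₄]; ring
  · rintro ⟨e₁, e₂, e₃, e₄, e₅⟩
    congr 1
    · rw [← e₃]; ring
    · rw [← e₄]; ring

/-! ### The interval, the normalization of g and the polar angle. -/

theorem isOpen_openInterval (a b : EReal) : IsOpen (openInterval a b) :=
  isOpen_Ioo.preimage continuous_coe_real_ereal

theorem isPreconnected_openInterval (a b : EReal) : IsPreconnected (openInterval a b) :=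
  Set.OrdConnected.isPreconnected ⟨fun _ hx _ hy _ hz =>
    ⟨hx.1.trans_le (EReal.coe_le_coe_iff.2 hz.1), (EReal.coe_le_coe_iff.2 hz.2).trans_lt hy.2⟩⟩

theorem openInterval_nonempty {a b : EReal} (hab : a < b) : (openInterval a b).Nonempty :=
  EReal.lt_iff_exists_real_btwn.1 hab

theorem mem_total_one {a b : EReal} {t : ℝ} (ht : t ∈ openInterval a b) :
    ((t, 1, 1) : Amb) ∈ total a b :=
  ⟨ht, one_ne_zero, one_ne_zero⟩

/-- The normalization of `g` determines the sign of `f₁` and its size in terms of `ψ`. -/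
theorem normalization {f₁ f₂ f₃ f₄ f₅ a₂ a₃ a₄ a₅ b₄ b₅ : ℝ}
    (hst : IsStable (psiVal a₂ a₃ a₄ a₅ 0 0 b₄ b₅))
    (h₀ : metric (omegaVal f₁ f₂ f₃ f₄ f₅) (psiVal a₂ a₃ a₄ a₅ 0 0 b₄ b₅) (stdB 0) (stdB 0) = 1)
    (h₁ : metric (omegaVal f₁ f₂ f₃ f₄ f₅) (psiVal a₂ a₃ a₄ a₅ 0 0 b₄ b₅) (stdB 0) (stdB 1) = 0) :
    f₁ * ((Real.sqrt (-quartic (psiVal a₂ a₃ a₄ a₅ 0 0 b₄ b₅)))⁻¹ *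
      (2 * (a₂ * a₃ - a₄ ^ 2 - a₅ ^ 2))) = 1 ∧ a₄ * b₄ + a₅ * b₅ = 0 ∧ f₁ < 0 ∧
      a₂ * a₃ - a₄ ^ 2 - a₅ ^ 2 < 0 ∧ 0 < b₄ ^ 2 + b₅ ^ 2 ∧
      f₁ ^ 2 * (a₂ * a₃ - a₄ ^ 2 - a₅ ^ 2) = -(b₄ ^ 2 + b₅ ^ 2) := by
  have hr := inv_sqrt_sq hst
  have hr₀ : 0 < (Real.sqrt (-quartic (psiVal a₂ a₃ a₄ a₅ 0 0 b₄ b₅)))⁻¹ :=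
    inv_pos.2 (Real.sqrt_pos.2 (neg_pos.2 hst))
  have hst' : quartic (psiVal a₂ a₃ a₄ a₅ 0 0 b₄ b₅) < 0 := hst
  rw [metric_xi] at h₀ h₁
  rw [quartic_psiVal] at hst'
  have hP := quartic_psiVal a₂ a₃ a₄ a₅ b₄ b₅
  generalize quartic (psiVal a₂ a₃ a₄ a₅ 0 0 b₄ b₅) = P at *
  generalize (Real.sqrt (-P))⁻¹ = r at *
  simp [stdB] at h₀ h₁
  have hf : f₁ ≠ 0 := fun h => by simp [h] at h₀
  have hc : a₄ * b₄ + a₅ * b₅ = 0 := by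
    rcases h₁ with h | h | h
    · exact absurd h hf
    · exact absurd h hr₀.ne'
    · linarith
  rw [hc] at hst' hP
  have hB : 0 < b₄ ^ 2 + b₅ ^ 2 := by
    rcases (by positivity : 0 ≤ b₄ ^ 2 + b₅ ^ 2).lt_or_eq with h | h
    · exact h
    · rw [← h] at hst'; simp at hst'
  have hN : a₂ * a₃ - a₄ ^ 2 - a₅ ^ 2 < 0 := by
    by_contra hN
    have := mul_nonneg (not_lt.1 hN) hB.le
    linarith
  refine ⟨h₀, hc, ?_, hN, hB, ?_⟩
  · by_contra hf'
    have := mul_nonneg (not_lt.1 hf') (mul_nonneg hr₀.le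
      (by linarith : 0 ≤ -(2 * (a₂ * a₃ - a₄ ^ 2 - a₅ ^ 2))))
    linarith
  · rw [hP] at hr
    -- Adding (2rNf₁)² = 1 and 4r²NB = -1 gives 4Nr²(f₁²N + B) = 0, and the prefactor can be
    -- cancelled.
    have h4 : 4 * (a₂ * a₃ - a₄ ^ 2 - a₅ ^ 2) * r ^ 2 ≠ 0 := by
      have := hN.ne
      have := hr₀.ne'
      positivity
    apply mul_left_cancel₀ h4
    linear_combination (f₁ * (r * (2 * (a₂ * a₃ - a₄ ^ 2 - a₅ ^ 2))) + 1) * h₀ + hr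

/-- Here P = 4NB = -(2f₁N)², and f₁N > 0 because both factors are negative; hence √(-P) = 2f₁N with
the correct sign. -/
theorem normalization_converse {f₁ a₂ a₃ a₄ a₅ b₄ b₅ : ℝ} (hc : a₄ * b₄ + a₅ * b₅ = 0)
    (hf : f₁ < 0) (hN : a₂ * a₃ - a₄ ^ 2 - a₅ ^ 2 < 0)
    (h : f₁ ^ 2 * (a₂ * a₃ - a₄ ^ 2 - a₅ ^ 2) = -(b₄ ^ 2 + b₅ ^ 2)) :
    IsStable (psiVal a₂ a₃ a₄ a₅ 0 0 b₄ b₅) ∧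
    f₁ * ((Real.sqrt (-quartic (psiVal a₂ a₃ a₄ a₅ 0 0 b₄ b₅)))⁻¹ *
      (2 * (a₂ * a₃ - a₄ ^ 2 - a₅ ^ 2))) = 1 := by
  have hpos : 0 < f₁ * (a₂ * a₃ - a₄ ^ 2 - a₅ ^ 2) := mul_pos_of_neg_of_neg hf hN
  have hP : quartic (psiVal a₂ a₃ a₄ a₅ 0 0 b₄ b₅) =
      -(2 * (f₁ * (a₂ * a₃ - a₄ ^ 2 - a₅ ^ 2))) ^ 2 := by
    rw [quartic_psiVal, hc]
    linear_combination 4 * (a₂ * a₃ - a₄ ^ 2 - a₅ ^ 2) * h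
  constructor
  · change quartic _ < 0
    rw [hP]
    have := pow_pos (mul_pos two_pos hpos) 2
    linarith
  · rw [hP, neg_neg, Real.sqrt_sq (by linarith)]
    have := hf.ne
    have := hN.ne
    field_simp

/-- A plane curve which avoids the origin and has velocity proportional to its position lies on a
ray. -/
theorem exists_polar_angle {s : Set ℝ} (hs : IsOpen s) (hc : IsPreconnected s) (hn : s.Nonempty)
    {f g : ℝ → ℝ} (hf : DifferentiableOn ℝ f s) (hg : DifferentiableOn ℝ g s)
    (hpos : ∀ t ∈ s, 0 < f t ^ 2 + g t ^ 2) (h : ∀ t ∈ s, deriv f t * g t = deriv g t * f t) :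
    ∃ θ : ℝ, ∀ t ∈ s, f t = Real.sqrt (f t ^ 2 + g t ^ 2) * Real.cos θ ∧
      g t = Real.sqrt (f t ^ 2 + g t ^ 2) * Real.sin θ := by
  obtain ⟨t₀, ht₀⟩ := hn
  -- With R the radius, the derivative of f/R is g(f'g - g'f)/R³ = 0. Stated for a general pair, it
  -- is used again with the roles exchanged, giving cosine and sine.
  have key : ∀ {f g : ℝ → ℝ}, DifferentiableOn ℝ f s → DifferentiableOn ℝ g s →
      (∀ t ∈ s, 0 < f t ^ 2 + g t ^ 2) → (∀ t ∈ s, deriv f t * g t = deriv g t * f t) →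
      ∀ t ∈ s, f t / Real.sqrt (f t ^ 2 + g t ^ 2) = f t₀ / Real.sqrt (f t₀ ^ 2 + g t₀ ^ 2) := by
    intro f g hf hg hpos h t ht
    have hd : ∀ t ∈ s, HasDerivAt (fun t => f t / Real.sqrt (f t ^ 2 + g t ^ 2)) 0 t := by
      intro t ht
      have df := (hf.differentiableAt (hs.mem_nhds ht)).hasDerivAt
      have dg := (hg.differentiableAt (hs.mem_nhds ht)).hasDerivAt
      have d := df.fun_div (((df.fun_pow 2).fun_add (dg.fun_pow 2)).sqrt (hpos t ht).ne')
        (Real.sqrt_pos.2 (hpos t ht)).ne'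
      refine d.congr_deriv ?_
      have hR := Real.sq_sqrt (hpos t ht).le
      have hR₀ := (Real.sqrt_pos.2 (hpos t ht)).ne'
      generalize Real.sqrt (f t ^ 2 + g t ^ 2) = R at *
      have e := h t ht
      field_simp
      simp
      rw [hR]
      linear_combination 2 * g t * e
    exact hs.is_const_of_deriv_eq_zero hc
      (fun t ht => (hd t ht).differentiableAt.differentiableWithinAt)
      (fun t ht => (hd t ht).deriv) ht ht₀
  have e₁ := key hf hg hpos h
  have e₂ := key hg hf (fun t ht => by rw [add_comm]; exact hpos t ht) fun t ht => (h t ht).symm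
  have hz : Real.sqrt (f t₀ ^ 2 + g t₀ ^ 2) = ‖(⟨f t₀, g t₀⟩ : ℂ)‖ := by
    rw [Complex.norm_def, Complex.normSq_mk, sq, sq]
  have hR₀ := (Real.sqrt_pos.2 (hpos t₀ ht₀)).ne'
  refine ⟨Complex.arg ⟨f t₀, g t₀⟩, fun t ht => ?_⟩
  have hR := (Real.sqrt_pos.2 (hpos t ht)).ne'
  have c₁ := Complex.norm_mul_cos_arg ⟨f t₀, g t₀⟩
  have c₂ := Complex.norm_mul_sin_arg ⟨f t₀, g t₀⟩
  rw [← hz] at c₁ c₂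
  have e₁ := e₁ t ht
  have e₂ := e₂ t ht
  rw [add_comm (g t ^ 2), add_comm (g t₀ ^ 2)] at e₂
  simp only at c₁ c₂
  rw [div_eq_iff hR] at e₁ e₂
  have k₁ : f t₀ / Real.sqrt (f t₀ ^ 2 + g t₀ ^ 2) = Real.cos (Complex.arg ⟨f t₀, g t₀⟩) := by
    rw [div_eq_iff hR₀, mul_comm]; exact c₁.symm
  have k₂ : g t₀ / Real.sqrt (f t₀ ^ 2 + g t₀ ^ 2) = Real.sin (Complex.arg ⟨f t₀, g t₀⟩) := by
    rw [div_eq_iff hR₀, mul_comm]; exact c₂.symm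
  rw [k₁, mul_comm] at e₁
  rw [k₂, mul_comm] at e₂
  exact ⟨e₁, e₂⟩

theorem omegaForm_eq_omegaVal (f₁ f₂ f₃ f₄ f₅ : ℝ → ℝ) (t : ℝ) :
    omegaForm f₁ f₂ f₃ f₄ f₅ t = omegaVal (f₁ t) (f₂ t) (f₃ t) (f₄ t) (f₅ t) :=
  rfl

theorem differentiableAt_of_contDiffOn {s : Set ℝ} (hs : IsOpen s) {f : ℝ → ℝ}
    (hf : ContDiffOn ℝ ∞ f s) {t : ℝ} (ht : t ∈ s) : DifferentiableAt ℝ f t :=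
  (hf.contDiffAt (hs.mem_nhds ht)).differentiableAt (by simp)

theorem coframe_xiField (u : Amb) : coframe u (xiField u) = stdB 0 := by
  ext i
  fin_cases i <;> simp [coframe, xiField, stdB]

theorem coframe_actionField_zero (u : Amb) (X₁ X₂ : ℍ[ℝ]) :
    coframe u (actionField X₁ X₂ u) 0 = 0 := by
  simp [coframe, actionField]

theorem psiForm_eq_psiVal {a₂ a₃ a₄ a₅ b₂ b₃ b₄ b₅ : ℝ → ℝ} {t : ℝ} (h₂ : b₂ t = 0)
    (h₃ : b₃ t = 0) : psiForm a₂ a₃ a₄ a₅ b₂ b₃ b₄ b₅ t =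
      psiVal (a₂ t) (a₃ t) (a₄ t) (a₅ t) 0 0 (b₄ t) (b₅ t) := by
  have h : psiForm a₂ a₃ a₄ a₅ b₂ b₃ b₄ b₅ t =
      psiVal (a₂ t) (a₃ t) (a₄ t) (a₅ t) (b₂ t) (b₃ t) (b₄ t) (b₅ t) := rfl
  rw [h, h₂, h₃]

/-! ### The coefficient equations, the first integral and the differential system. -/

section

variable {a b : EReal} {μ : ℝ} {f₁ f₂ f₃ f₄ f₅ p₁₂ p₁₃ p₁₄ p₁₅ p₂₂ p₂₃ p₂₄ p₂₅ F : ℝ → ℝ} {θ₀ : ℝ}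

/-- The equation `dω = 3 ψ` in terms of coefficients. -/
theorem psiCoefficients_iff (hf₁ : ContDiffOn ℝ ∞ f₁ (openInterval a b))
    (hf₂ : ContDiffOn ℝ ∞ f₂ (openInterval a b)) (hf₃ : ContDiffOn ℝ ∞ f₃ (openInterval a b))
    (hf₄ : ContDiffOn ℝ ∞ f₄ (openInterval a b)) (hf₅ : ContDiffOn ℝ ∞ f₅ (openInterval a b)) :
    (∀ u ∈ total a b, extDeriv (invForm (omegaForm f₁ f₂ f₃ f₄ f₅)) u =
      (3 : ℝ) • invForm (psiForm p₁₂ p₁₃ p₁₄ p₁₅ p₂₂ p₂₃ p₂₄ p₂₅) u) ↔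
    PsiCoefficients a b f₁ f₂ f₃ f₄ f₅ p₁₂ p₁₃ p₁₄ p₁₅ p₂₂ p₂₃ p₂₄ p₂₅ := by
  have key : ∀ u ∈ total a b, extDeriv (invForm (omegaForm f₁ f₂ f₃ f₄ f₅)) u =
      (3 : ℝ) • invForm (psiForm p₁₂ p₁₃ p₁₄ p₁₅ p₂₂ p₂₃ p₂₄ p₂₅) u ↔
      psiVal (deriv f₂ u.1 + f₁ u.1 / 4) (deriv f₃ u.1 - f₁ u.1 / 4) (deriv f₄ u.1) (deriv f₅ u.1)
        0 0 (2 * f₅ u.1) (-2 * f₄ u.1) = psiVal (3 * p₁₂ u.1) (3 * p₁₃ u.1) (3 * p₁₄ u.1)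
        (3 * p₁₅ u.1) (3 * p₂₂ u.1) (3 * p₂₃ u.1) (3 * p₂₄ u.1) (3 * p₂₅ u.1) := by
    intro u hu
    have d : ∀ {f : ℝ → ℝ}, ContDiffOn ℝ ∞ f (openInterval a b) →
        HasDerivAt f (deriv f u.1) u.1 := fun hf =>
      (differentiableAt_of_contDiffOn (isOpen_openInterval a b) hf hu.1).hasDerivAt
    rw [extDeriv_omegaForm_eq_iff u hu.2.1 hu.2.2 (d hf₁) (d hf₂) (d hf₃) (d hf₄) (d hf₅),
      ← smul_psiVal]
    rfl
  constructor
  · intro h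
    have e := fun t ht => psiVal_inj ((key (t, 1, 1) (mem_total_one ht)).1
      (h (t, 1, 1) (mem_total_one ht)))
    constructor <;> intro t ht <;> obtain ⟨⟨e₁, e₂, e₃, e₄⟩, e₅, e₆, e₇, e₈⟩ := e t ht <;>
      simp only at e₁ e₂ e₃ e₄ e₅ e₆ e₇ e₈ <;> linarith
  · intro h u hu
    rw [key u hu, h.h12 _ hu.1, h.h13 _ hu.1, h.h14 _ hu.1, h.h15 _ hu.1, h.h22 _ hu.1,
      h.h23 _ hu.1, h.h24 _ hu.1, h.h25 _ hu.1]
    congr 1 <;> ring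

/-- The differential system, the first integral and the compatibility condition `ω ∧ ψ = 0`. -/
theorem first_integral (hμ : 0 < μ) (hf₁ : ContDiffOn ℝ ∞ f₁ (openInterval a b))
    (hf₂ : ContDiffOn ℝ ∞ f₂ (openInterval a b)) (hf₃ : ContDiffOn ℝ ∞ f₃ (openInterval a b))
    (hF : ContDiffOn ℝ ∞ F (openInterval a b)) (hn : ∀ t ∈ openInterval a b, f₁ t ≠ 0)
    (hD : DiffSystem a b μ f₁ f₂ f₃ F) :
    (∀ t ∈ openInterval a b, f₂ t * (deriv f₃ t - f₁ t / 4) + f₃ t * (deriv f₂ t + f₁ t / 4) -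
      2 * F t * deriv F t = 0) ∧
    ∀ t ∈ openInterval a b, ∀ t₀ ∈ openInterval a b,
      4 * F t ^ 2 - (deriv F t ^ 2 - (deriv f₂ t + f₁ t / 4) * (deriv f₃ t - f₁ t / 4)) * f₁ t ^ 2 =
      4 * F t₀ ^ 2 - (deriv F t₀ ^ 2 -
        (deriv f₂ t₀ + f₁ t₀ / 4) * (deriv f₃ t₀ - f₁ t₀ / 4)) * f₁ t₀ ^ 2 := by
  have hopen := isOpen_openInterval a b
  have d : ∀ {f : ℝ → ℝ}, ContDiffOn ℝ ∞ f (openInterval a b) → ∀ t ∈ openInterval a b,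
      HasDerivAt f (deriv f t) t := fun hf t ht =>
    (differentiableAt_of_contDiffOn hopen hf ht).hasDerivAt
  have d' : ∀ {f : ℝ → ℝ}, ContDiffOn ℝ ∞ f (openInterval a b) → ∀ t ∈ openInterval a b,
      DifferentiableAt ℝ (deriv f) t := fun hf t ht =>
    differentiableAt_of_contDiffOn hopen (hf.deriv_of_isOpen (m := ∞) hopen (by simp)) ht
  have hA : ∀ t ∈ openInterval a b, HasDerivAt (fun s => (deriv f₂ s + 1 / 4 * f₁ s) * f₁ s)
      (-(12 * μ * f₁ t * f₂ t)) t := fun t ht => by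
    have h := (((d' hf₂ t ht).fun_add ((d hf₁ t ht).differentiableAt.const_mul (1 / 4))).fun_mul
      (d hf₁ t ht).differentiableAt).hasDerivAt
    exact h.congr_deriv (by linarith [hD.eq1 t ht])
  have hB : ∀ t ∈ openInterval a b, HasDerivAt (fun s => (deriv f₃ s - 1 / 4 * f₁ s) * f₁ s)
      (-(12 * μ * f₁ t * f₃ t)) t := fun t ht => by
    have h := (((d' hf₃ t ht).fun_sub ((d hf₁ t ht).differentiableAt.const_mul (1 / 4))).fun_mul
      (d hf₁ t ht).differentiableAt).hasDerivAt
    exact h.congr_deriv (by linarith [hD.eq2 t ht])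
  have hC : ∀ t ∈ openInterval a b, HasDerivAt (fun s => deriv F s * f₁ s)
      (4 * (F t / f₁ t) - 12 * μ * f₁ t * F t) t := fun t ht => by
    have h := ((d' hF t ht).fun_mul (d hf₁ t ht).differentiableAt).hasDerivAt
    exact h.congr_deriv (by linarith [hD.eq3 t ht])
  -- The fourth equation holds on an open set, so it may be differentiated; the first two equations
  -- eliminate the second derivatives, and a factor 48μ ≠ 0 is cancelled.
  have hG : ∀ t ∈ openInterval a b, f₂ t * (deriv f₃ t - f₁ t / 4) +
      f₃ t * (deriv f₂ t + f₁ t / 4) - 2 * F t * deriv F t = 0 := fun t ht => by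
    have h := ((hA t ht).fun_sub (hB t ht)).fun_add ((((d hf₂ t ht).fun_mul (d hf₃ t ht)).fun_sub
      ((d hF t ht).fun_pow 2)).const_mul (48 * μ))
    have h0 : (fun s => (deriv f₂ s + 1 / 4 * f₁ s) * f₁ s - (deriv f₃ s - 1 / 4 * f₁ s) * f₁ s +
        48 * μ * (f₂ s * f₃ s - F s ^ 2)) =ᶠ[nhds t] fun _ => 0 := by
      filter_upwards [hopen.mem_nhds ht] with s hs
      linear_combination hD.eq4 s hs
    have e := h.unique ((hasDerivAt_const t (0 : ℝ)).congr_of_eventuallyEq h0)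
    apply mul_left_cancel₀ (by positivity : 48 * μ ≠ 0)
    simp at e
    linear_combination e
  refine ⟨hG, fun t ht t₀ ht₀ => ?_⟩
  -- By the first three equations the derivative is -12μf₁² times the expression in `hG`: the term
  -- 8FF' from 4F² cancels against the 4F/f₁ of the third equation.
  have hQ : ∀ t ∈ openInterval a b, HasDerivAt (fun t => 4 * F t ^ 2 - (deriv F t * f₁ t) ^ 2 +
      (deriv f₂ t + 1 / 4 * f₁ t) * f₁ t * ((deriv f₃ t - 1 / 4 * f₁ t) * f₁ t)) 0 t := by
    intro t ht
    have h := ((((d hF t ht).fun_pow 2).const_mul 4).fun_sub ((hC t ht).fun_pow 2)).fun_add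
      ((hA t ht).fun_mul (hB t ht))
    refine h.congr_deriv ?_
    have h₁ := hn t ht
    have e := hG t ht
    have e' : F t / f₁ t * f₁ t = F t := div_mul_cancel₀ _ h₁
    simp
    linear_combination -(12 * μ * f₁ t ^ 2) * e - 8 * deriv F t * e'
  have hc := hopen.is_const_of_deriv_eq_zero (isPreconnected_openInterval a b)
    (fun t ht => (hQ t ht).differentiableAt.differentiableWithinAt)
    (fun t ht => (hQ t ht).deriv) ht ht₀
  linear_combination hc

end

section

variable {a b : EReal} {μ : ℝ} {f₁ f₂ f₃ f₄ f₅ p₁₂ p₁₃ p₁₄ p₁₅ p₂₂ p₂₃ p₂₄ p₂₅ F : ℝ → ℝ} {θ₀ : ℝ}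

/-- The derivative of a function which is proportional to `F` on an open set. -/
theorem deriv_of_eq_mul_const {s : Set ℝ} (hs : IsOpen s) {f F : ℝ → ℝ} {c : ℝ}
    (h : ∀ t ∈ s, f t = F t * c) {t : ℝ} (ht : t ∈ s) : deriv f t = deriv F t * c := by
  have e : f =ᶠ[nhds t] fun t => F t * c := by
    filter_upwards [hs.mem_nhds ht] with r hr using h r hr
  rw [e.deriv_eq, deriv_mul_const_field]

/-- Given the coefficients of `ψ`, the normalization of `J^* ψ` and the polar form of `(f₄, f₅)`,
the equation `d (J^* ψ) = -2 μ ω ∧ ω` amounts to the differential system. -/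
theorem extDeriv_jPull_iff_diffSystem
    (hf₁ : ContDiffOn ℝ ∞ f₁ (openInterval a b))
    (hp₁₂ : ContDiffOn ℝ ∞ p₁₂ (openInterval a b)) (hp₁₃ : ContDiffOn ℝ ∞ p₁₃ (openInterval a b))
    (hp₁₄ : ContDiffOn ℝ ∞ p₁₄ (openInterval a b)) (hp₁₅ : ContDiffOn ℝ ∞ p₁₅ (openInterval a b))
    (hp₂₄ : ContDiffOn ℝ ∞ p₂₄ (openInterval a b)) (hp₂₅ : ContDiffOn ℝ ∞ p₂₅ (openInterval a b))
    (hP : PsiCoefficients a b f₁ f₂ f₃ f₄ f₅ p₁₂ p₁₃ p₁₄ p₁₅ p₂₂ p₂₃ p₂₄ p₂₅)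
    (hn : ∀ t ∈ openInterval a b, f₁ t ≠ 0)
    (h₄ : ∀ t ∈ openInterval a b, f₄ t = F t * Real.cos θ₀)
    (h₅ : ∀ t ∈ openInterval a b, f₅ t = F t * Real.sin θ₀)
    (hJ : ∀ t ∈ openInterval a b, jPull (psiForm p₁₂ p₁₃ p₁₄ p₁₅ p₂₂ p₂₃ p₂₄ p₂₅ t) =
      psiVal 0 0 (-(p₂₄ t / f₁ t)) (-(p₂₅ t / f₁ t)) (f₁ t * p₁₂ t) (f₁ t * p₁₃ t) (f₁ t * p₁₄ t)
        (f₁ t * p₁₅ t)) :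
    (∀ u ∈ total a b,
      extDeriv (invForm fun t => jPull (psiForm p₁₂ p₁₃ p₁₄ p₁₅ p₂₂ p₂₃ p₂₄ p₂₅ t)) u =
        (-2 * μ) • invForm (fun t => wedge (omegaForm f₁ f₂ f₃ f₄ f₅ t)
          (omegaForm f₁ f₂ f₃ f₄ f₅ t)) u) ↔ DiffSystem a b μ f₁ f₂ f₃ F := by
  have hopen := isOpen_openInterval a b
  have key : ∀ u ∈ total a b, _ := fun u hu => extDeriv_jPull_eq_iff (f₂ := f₂) (f₃ := f₃)
    (f₄ := f₄) (f₅ := f₅) (ps := psiForm p₁₂ p₁₃ p₁₄ p₁₅ p₂₂ p₂₃ p₂₄ p₂₅) u hu.2.1 hu.2.2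
    (by filter_upwards [hopen.mem_nhds hu.1] with t ht using hJ t ht) (hn _ hu.1)
    (differentiableAt_of_contDiffOn hopen hf₁ hu.1) (differentiableAt_of_contDiffOn hopen hp₁₂ hu.1)
    (differentiableAt_of_contDiffOn hopen hp₁₃ hu.1)
    (differentiableAt_of_contDiffOn hopen hp₁₄ hu.1)
    (differentiableAt_of_contDiffOn hopen hp₁₅ hu.1)
    (differentiableAt_of_contDiffOn hopen hp₂₄ hu.1)
    (differentiableAt_of_contDiffOn hopen hp₂₅ hu.1) (-2 * μ)
  have d₂ : ∀ t ∈ openInterval a b, deriv (fun s => (deriv f₂ s + 1 / 4 * f₁ s) * f₁ s) t =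
      deriv (fun s => f₁ s * p₁₂ s) t * 3 := fun t ht =>
    deriv_of_eq_mul_const hopen (fun s hs => by rw [hP.h12 s hs]; ring) ht
  have d₃ : ∀ t ∈ openInterval a b, deriv (fun s => (deriv f₃ s - 1 / 4 * f₁ s) * f₁ s) t =
      deriv (fun s => f₁ s * p₁₃ s) t * 3 := fun t ht =>
    deriv_of_eq_mul_const hopen (fun s hs => by rw [hP.h13 s hs]; ring) ht
  have d₄ : ∀ t ∈ openInterval a b, deriv (fun s => f₁ s * p₁₄ s) t =
      deriv (fun s => deriv F s * f₁ s) t * (Real.cos θ₀ / 3) := fun t ht =>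
    deriv_of_eq_mul_const hopen
      (fun s hs => by rw [hP.h14 s hs, deriv_of_eq_mul_const hopen h₄ hs]; ring) ht
  have d₅ : ∀ t ∈ openInterval a b, deriv (fun s => f₁ s * p₁₅ s) t =
      deriv (fun s => deriv F s * f₁ s) t * (Real.sin θ₀ / 3) := fun t ht =>
    deriv_of_eq_mul_const hopen
      (fun s hs => by rw [hP.h15 s hs, deriv_of_eq_mul_const hopen h₅ hs]; ring) ht
  have hcs := Real.sin_sq_add_cos_sq θ₀
  constructor
  · intro h
    have e := fun t ht => (key (t, 1, 1) (mem_total_one ht)).1 (h _ (mem_total_one ht))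
    constructor <;> intro t ht <;> obtain ⟨e₁, e₂, e₃, e₄, e₅⟩ := e t ht
    · rw [d₂ t ht, e₁]; ring
    · rw [d₃ t ht, e₂]; ring
    · simp only [d₄ t ht, d₅ t ht, hP.h24 t ht, hP.h25 t ht, h₄ t ht, h₅ t ht] at e₃ e₄
      -- The ω⁴- and ω⁵-components are one scalar equation multiplied by cos θ₀ and sin θ₀;
      -- recombining with these weights recovers it even if one of them vanishes.
      linear_combination 3 * Real.cos θ₀ * e₃ + 3 * Real.sin θ₀ * e₄ -
        (deriv (fun s => deriv F s * f₁ s) t - 4 * (F t / f₁ t) + 12 * μ * f₁ t * F t) * hcs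
    · simp only [hP.h12 t ht, hP.h13 t ht, h₄ t ht, h₅ t ht] at e₅
      linear_combination 12 * e₅ + 48 * μ * F t ^ 2 * hcs
  · intro h u hu
    have ht := hu.1
    rw [key u hu]
    refine ⟨?_, ?_, ?_, ?_, ?_⟩
    · linear_combination 1 / 3 * h.eq1 _ ht - 1 / 3 * d₂ _ ht
    · linear_combination 1 / 3 * h.eq2 _ ht - 1 / 3 * d₃ _ ht
    · rw [d₄ _ ht, hP.h25 _ ht, h₄ _ ht]
      linear_combination Real.cos θ₀ / 3 * h.eq3 _ ht
    · rw [d₅ _ ht, hP.h24 _ ht, h₅ _ ht]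
      linear_combination Real.sin θ₀ / 3 * h.eq3 _ ht
    · rw [hP.h12 _ ht, hP.h13 _ ht, h₄ _ ht, h₅ _ ht]
      linear_combination 1 / 12 * h.eq4 _ ht - 4 * μ * F u.1 ^ 2 * hcs

/-- Translates the sign condition N < 0 from stability into the discriminant inequality for F, f₁,
f₂, f₃; the factor 1/9 comes from ψ = dω/3. -/
theorem disc_psiCoefficients
    (hP : PsiCoefficients a b f₁ f₂ f₃ f₄ f₅ p₁₂ p₁₃ p₁₄ p₁₅ p₂₂ p₂₃ p₂₄ p₂₅)
    (h₄ : ∀ t ∈ openInterval a b, f₄ t = F t * Real.cos θ₀)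
    (h₅ : ∀ t ∈ openInterval a b, f₅ t = F t * Real.sin θ₀) {t : ℝ} (ht : t ∈ openInterval a b) :
    p₁₂ t * p₁₃ t - p₁₄ t ^ 2 - p₁₅ t ^ 2 =
      -(1 / 9) * (deriv F t ^ 2 - (deriv f₂ t + f₁ t / 4) * (deriv f₃ t - f₁ t / 4)) := by
  rw [hP.h12 t ht, hP.h13 t ht, hP.h14 t ht, hP.h15 t ht,
    deriv_of_eq_mul_const (isOpen_openInterval a b) h₄ ht,
    deriv_of_eq_mul_const (isOpen_openInterval a b) h₅ ht]
  linear_combination -(1 / 9) * deriv F t ^ 2 * Real.sin_sq_add_cos_sq θ₀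

end

end NearlyKahler

end
-- Proof of the equivalence.
open NearlyKahler in
theorem theorem3p3 (a b : EReal) (hab : a < b) (μ : ℝ) (hμ : 0 < μ)
    (f₁ f₂ f₃ f₄ f₅ p₁₂ p₁₃ p₁₄ p₁₅ p₂₂ p₂₃ p₂₄ p₂₅ : ℝ → ℝ)
    (hf₁ : ContDiffOn ℝ ∞ f₁ (openInterval a b)) (hf₂ : ContDiffOn ℝ ∞ f₂ (openInterval a b))
    (hf₃ : ContDiffOn ℝ ∞ f₃ (openInterval a b)) (hf₄ : ContDiffOn ℝ ∞ f₄ (openInterval a b))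
    (hf₅ : ContDiffOn ℝ ∞ f₅ (openInterval a b))
    (hp₁₂ : ContDiffOn ℝ ∞ p₁₂ (openInterval a b)) (hp₁₃ : ContDiffOn ℝ ∞ p₁₃ (openInterval a b))
    (hp₁₄ : ContDiffOn ℝ ∞ p₁₄ (openInterval a b)) (hp₁₅ : ContDiffOn ℝ ∞ p₁₅ (openInterval a b))
    (hp₂₂ : ContDiffOn ℝ ∞ p₂₂ (openInterval a b)) (hp₂₃ : ContDiffOn ℝ ∞ p₂₃ (openInterval a b))
    (hp₂₄ : ContDiffOn ℝ ∞ p₂₄ (openInterval a b)) (hp₂₅ : ContDiffOn ℝ ∞ p₂₅ (openInterval a b)) :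
    (ReyesCarrionHitchin a b μ (omegaForm f₁ f₂ f₃ f₄ f₅)
        (psiForm p₁₂ p₁₃ p₁₄ p₁₅ p₂₂ p₂₃ p₂₄ p₂₅) ∧
      Normalized a b (omegaForm f₁ f₂ f₃ f₄ f₅) (psiForm p₁₂ p₁₃ p₁₄ p₁₅ p₂₂ p₂₃ p₂₄ p₂₅)) ↔
    (PsiCoefficients a b f₁ f₂ f₃ f₄ f₅ p₁₂ p₁₃ p₁₄ p₁₅ p₂₂ p₂₃ p₂₄ p₂₅ ∧
      ∃ (θ₀ : ℝ) (F : ℝ → ℝ), ContDiffOn ℝ ∞ F (openInterval a b) ∧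
        (∀ t ∈ openInterval a b, 0 < F t) ∧
        (∀ t ∈ openInterval a b, f₄ t = F t * Real.cos θ₀ ∧ f₅ t = F t * Real.sin θ₀) ∧
        (∀ t ∈ openInterval a b, f₁ t < 0 ∧
          0 < deriv F t ^ 2 - (deriv f₂ t + f₁ t / 4) * (deriv f₃ t - f₁ t / 4)) ∧
        DiffSystem a b μ f₁ f₂ f₃ F ∧
        ∃ t₀ ∈ openInterval a b,
          4 * F t₀ ^ 2 - (deriv F t₀ ^ 2 -
            (deriv f₂ t₀ + f₁ t₀ / 4) * (deriv f₃ t₀ - f₁ t₀ / 4)) * f₁ t₀ ^ 2 = 0) := by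
  have hopen := isOpen_openInterval a b
  constructor
  · rintro ⟨⟨hst, -, hdω, hdψ⟩, hnorm⟩
    have hP := (psiCoefficients_iff hf₁ hf₂ hf₃ hf₄ hf₅).1 hdω
    have hψ : ∀ t ∈ openInterval a b, psiForm p₁₂ p₁₃ p₁₄ p₁₅ p₂₂ p₂₃ p₂₄ p₂₅ t =
        psiVal (p₁₂ t) (p₁₃ t) (p₁₄ t) (p₁₅ t) 0 0 (p₂₄ t) (p₂₅ t) := fun t ht =>
      psiForm_eq_psiVal (hP.h22 t ht) (hP.h23 t ht)
    have hN := fun t (ht : t ∈ openInterval a b) =>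
      normalization (f₁ := f₁ t) (f₂ := f₂ t) (f₃ := f₃ t) (f₄ := f₄ t) (f₅ := f₅ t)
        (hψ t ht ▸ hst t ht)
        (by
          have h := (hnorm (t, 1, 1) (mem_total_one ht)).1
          rwa [coframe_xiField, hψ t ht, omegaForm_eq_omegaVal] at h)
        (by
          -- The direction A = (H, -H) gives all that is needed from orthogonality, since g(ξ, ·)
          -- involves only the ξ- and A-coordinates.
          have h := (hnorm (t, 1, 1) (mem_total_one ht)).2 qH (-qH) rfl (by simp)
          rwa [coframe_xiField, (coframe_along_gamma t).2.1, hψ t ht, omegaForm_eq_omegaVal] at h)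
    have hpos : ∀ t ∈ openInterval a b, 0 < f₄ t ^ 2 + f₅ t ^ 2 := fun t ht => by
      have h := (hN t ht).2.2.2.2.1
      rw [hP.h24 t ht, hP.h25 t ht] at h
      linarith
    have hprop : ∀ t ∈ openInterval a b, deriv f₄ t * f₅ t = deriv f₅ t * f₄ t := fun t ht => by
      have h := (hN t ht).2.1
      rw [hP.h14 t ht, hP.h15 t ht, hP.h24 t ht, hP.h25 t ht] at h
      linear_combination 9 / 2 * h
    obtain ⟨θ₀, hθ⟩ := exists_polar_angle hopen (isPreconnected_openInterval a b)
      (openInterval_nonempty hab) (hf₄.differentiableOn (by simp)) (hf₅.differentiableOn (by simp))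
      hpos hprop
    obtain ⟨F, hF, hF₀, h₄, h₅⟩ : ∃ F : ℝ → ℝ, ContDiffOn ℝ ∞ F (openInterval a b) ∧
        (∀ t ∈ openInterval a b, 0 < F t) ∧
        (∀ t ∈ openInterval a b, f₄ t = F t * Real.cos θ₀) ∧
        ∀ t ∈ openInterval a b, f₅ t = F t * Real.sin θ₀ :=
      ⟨fun t => Real.sqrt (f₄ t ^ 2 + f₅ t ^ 2),
        ((hf₄.pow 2).add (hf₅.pow 2)).sqrt fun t ht => (hpos t ht).ne',
        fun t ht => Real.sqrt_pos.2 (hpos t ht), fun t ht => (hθ t ht).1, fun t ht => (hθ t ht).2⟩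
    have hdisc := fun t ht => disc_psiCoefficients hP h₄ h₅ (t := t) ht
    obtain ⟨t₀, ht₀⟩ := openInterval_nonempty hab
    refine ⟨hP, θ₀, F, hF, hF₀, fun t ht => ⟨h₄ t ht, h₅ t ht⟩, fun t ht => ⟨(hN t ht).2.2.1, ?_⟩,
      (extDeriv_jPull_iff_diffSystem hf₁ hp₁₂ hp₁₃ hp₁₄ hp₁₅ hp₂₄ hp₂₅ hP
        (fun t ht => (hN t ht).2.2.1.ne) h₄ h₅ fun t ht => ?_).1 hdψ, t₀, ht₀, ?_⟩
    · linarith [hdisc t ht, (hN t ht).2.2.2.1]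
    · rw [hψ t ht]
      exact jPull_psiVal _ _ _ _ _ _ (hN t ht).2.1 (hN t ht).2.2.1.ne (hψ t ht ▸ hst t ht)
        (hN t ht).1
    · have h := (hN t₀ ht₀).2.2.2.2.2
      rw [hdisc t₀ ht₀, hP.h24 t₀ ht₀, hP.h25 t₀ ht₀, h₄ t₀ ht₀, h₅ t₀ ht₀] at h
      linear_combination 9 * h - 4 * F t₀ ^ 2 * Real.sin_sq_add_cos_sq θ₀
  · rintro ⟨hP, θ₀, F, hF, hF₀, hθ, hneg, hD, t₀, ht₀, h₀⟩
    have h₄ := fun t ht => (hθ t ht).1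
    have h₅ := fun t ht => (hθ t ht).2
    have hcs := Real.sin_sq_add_cos_sq θ₀
    have hψ : ∀ t ∈ openInterval a b, psiForm p₁₂ p₁₃ p₁₄ p₁₅ p₂₂ p₂₃ p₂₄ p₂₅ t =
        psiVal (p₁₂ t) (p₁₃ t) (p₁₄ t) (p₁₅ t) 0 0 (p₂₄ t) (p₂₅ t) := fun t ht =>
      psiForm_eq_psiVal (hP.h22 t ht) (hP.h23 t ht)
    -- `hcomp` yields the J-invariance of ω, and `hconst` carries the algebraic relation from t₀ to
    -- every t.
    obtain ⟨hcomp, hconst⟩ := first_integral hμ hf₁ hf₂ hf₃ hF (fun t ht => (hneg t ht).1.ne) hD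
    have hc : ∀ t ∈ openInterval a b, p₁₄ t * p₂₄ t + p₁₅ t * p₂₅ t = 0 := fun t ht => by
      rw [hP.h14 t ht, hP.h15 t ht, hP.h24 t ht, hP.h25 t ht, deriv_of_eq_mul_const hopen h₄ ht,
        deriv_of_eq_mul_const hopen h₅ ht, h₄ t ht, h₅ t ht]
      ring
    have hdisc := fun t ht => disc_psiCoefficients hP h₄ h₅ (t := t) ht
    have hN := fun t (ht : t ∈ openInterval a b) => normalization_converse (hc t ht) (hneg t ht).1
      (by rw [hdisc t ht]; linarith [(hneg t ht).2])
      (by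
        rw [hdisc t ht, hP.h24 t ht, hP.h25 t ht, h₄ t ht, h₅ t ht]
        linear_combination 1 / 9 * hconst t ht t₀ ht₀ + 1 / 9 * h₀ + 4 / 9 * F t ^ 2 * hcs)
    have hst : ∀ t ∈ openInterval a b,
        IsStable (psiForm p₁₂ p₁₃ p₁₄ p₁₅ p₂₂ p₂₃ p₂₄ p₂₅ t) := fun t ht => by
      rw [hψ t ht]; exact (hN t ht).1
    refine ⟨⟨hst, fun t ht v w => ?_, (psiCoefficients_iff hf₁ hf₂ hf₃ hf₄ hf₅).2 hP, ?_⟩, ?_⟩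
    · rw [hψ t ht, omegaForm_eq_omegaVal]
      refine omegaVal_jEnd _ _ _ _ _ _ _ _ _ _ _ ?_ ?_ (hN t ht).1 v w
      · rw [hP.h12 t ht, hP.h13 t ht, hP.h14 t ht, hP.h15 t ht,
          deriv_of_eq_mul_const hopen h₄ ht, deriv_of_eq_mul_const hopen h₅ ht, h₄ t ht, h₅ t ht]
        linear_combination 1 / 3 * hcomp t ht - 2 / 3 * F t * deriv F t * hcs
      · rw [hP.h24 t ht, hP.h25 t ht]
        ring
    · refine (extDeriv_jPull_iff_diffSystem hf₁ hp₁₂ hp₁₃ hp₁₄ hp₁₅ hp₂₄ hp₂₅ hP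
        (fun t ht => (hneg t ht).1.ne) h₄ h₅ fun t ht => ?_).2 hD
      rw [hψ t ht]
      exact jPull_psiVal _ _ _ _ _ _ (hc t ht) (hneg t ht).1.ne (hN t ht).1 (hN t ht).2
    · intro u hu
      rw [coframe_xiField, hψ _ hu.1, omegaForm_eq_omegaVal, metric_xi]
      refine ⟨?_, fun X₁ X₂ _ _ => ?_⟩
      · have h := (hN _ hu.1).2
        simpa [stdB] using h
      -- An action field has no ξ-component, and the coefficient of its A-component in g(ξ, ·) is a
      -- multiple of a₄b₄ + a₅b₅ = 0.
      · rw [metric_xi, coframe_actionField_zero, hc _ hu.1]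
        simp
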